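/- Let $X$ be a finite connected CW complex and let $\partial X\subseteq X$ be a subcomplex, called the boundary (possibly empty; for a cellulated manifold it is the boundary of the manifold). Put one qubit on every one-cell (edge) of $X$ not contained in $\partial X$. For every zero-cell (site) $v\notin\partial X$ let $\mathrm{St}(v)$ be the product of the Pauli operators $X(e)$ over all oriented edges starting at $v$ (an edge with both ends at $v$ counts twice). For every two-cell (plaquette) $p\not\subseteq\partial X$ let $Z(p)$ be the product of the Pauli operators $Z(e)$ over the edges $e\not\subseteq\partial X$ along the boundary of $p$, each raised to the power of the incidence number of $p$ with $e$ (the degree of the attaching map of $p$ over $e$; only its parity matters). For $g,\lambda>0$ let $$H=-\frac1{g^2}\sum_{p\not\subseteq\partial X}Z(p)-\lambda\sum_{v\notin\partial X}\mathrm{St}(v)$$ be the toric-code Hamiltonian, and call the dimension of the eigenspace of its lowest eigenvalue the ground-state degeneracy. Let $b_n(\cdot)=\dim H_n(\cdot\,;\mathbb Z_2)$ (cellular homology), and let $b_1^{NT}(\partial X)$ be the number of independent one-cycles of $\partial X$ modulo those that are boundaries in $X$, i.e. the rank of the map $H_1(\partial X;\mathbb Z_2)\to H_1(X;\mathbb Z_2)$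 induced by the inclusion. Then: 1. The ground states of $H$ are exactly the states on which all $Z(p)$ and all $\mathrm{St}(v)$ act as the identity. 2. If $\partial X=\emptyset$, the ground-state degeneracy is $2^{b_1(X)}$. 3. If $\partial X\neq\emptyset$, the ground-state degeneracy is $2^{\,b_0(\partial X)-1+b_1(X)-b_1^{NT}(\partial X)}$. 4. If there is a homeomorphism from $X$ to the closed ball $B^k$ that maps $\partial X$ onto the sphere $\partial B^k=\mathbb S^{k-1}$, where $k\neq 1$, then the ground state is unique, i.e. the degeneracy is $1$. -/

import Mathlib

noncomputable section

namespace ToricCode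

/-! ### Qubits and Pauli operators -/

/-- The Hilbert space of one qubit for every element of `E`: square-summable wave functions on
the set of `ℤ/2`-valued configurations `s : E → ZMod 2` (the computational basis states `|s⟩`). -/
abbrev QubitSpace (E : Type*) := EuclideanSpace ℂ (E → ZMod 2)

/-- The Pauli operator `Z(e)`, that is `Z(e) |s⟩ = (-1)^{s e} |s⟩`. -/
def pauliZ {E : Type*} (e : E) : Module.End ℂ (QubitSpace E) where
  toFun ψ := WithLp.toLp 2 fun s => (-1 : ℂ) ^ (s e).val * ψ s
  map_add' ψ φ := by ext s; simp [mul_add]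
  map_smul' c ψ := by ext s; simp [mul_left_comm]

/-- The Pauli operator `X(e)`, that is `X(e) |s⟩ = |s + δ_e⟩`: it flips the qubit at `e`. -/
def pauliX {E : Type*} [DecidableEq E] (e : E) : Module.End ℂ (QubitSpace E) where
  toFun ψ := WithLp.toLp 2 fun s => ψ (s + Pi.single e 1)
  map_add' ψ φ := by ext s; simp
  map_smul' c ψ := by ext s; simp

theorem pauliZ_commute {E : Type*} (e f : E) : Commute (pauliZ e) (pauliZ f) := by
  refine LinearMap.ext fun ψ => ?_
  ext s
  simp [pauliZ, mul_left_comm]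

theorem pauliX_commute {E : Type*} [DecidableEq E] (e f : E) :
    Commute (pauliX e) (pauliX f) := by
  refine LinearMap.ext fun ψ => ?_
  ext s
  simp [pauliX, add_right_comm]

/-- The operator `∏_e Z(e)^{k e}`. -/
def zString {E : Type*} [Fintype E] (k : E → ℕ) : Module.End ℂ (QubitSpace E) :=
  Finset.univ.noncommProd (fun e => pauliZ e ^ k e)
    fun e _ f _ _ => (pauliZ_commute e f).pow_pow _ _

/-- The operator `∏_e X(e)^{k e}`. -/
def xString {E : Type*} [Fintype E] [DecidableEq E] (k : E → ℕ) :
    Module.End ℂ (QubitSpace E) :=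
  Finset.univ.noncommProd (fun e => pauliX e ^ k e)
    fun e _ f _ _ => (pauliX_commute e f).pow_pow _ _

/-- `E₀` is the ground-state energy of `H`: the least real eigenvalue. -/
def IsGroundEnergy {V : Type*} [AddCommGroup V] [Module ℂ V] (H : Module.End ℂ V) (E₀ : ℝ) :
    Prop :=
  IsLeast {E : ℝ | Module.End.HasEigenvalue H (E : ℂ)} E₀

/-! ### Incidence numbers of a CW complex in dimensions at most two -/

open Topology Topology.CWComplex

/-- `n` is the winding number of the loop `ℓ : [0, 1] → ℝ/ℤ`: there is a continuous lift of `ℓ`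
to `ℝ` whose end point exceeds its starting point by `n`. -/
def HasWindingNumber (ℓ : ℝ → AddCircle (1 : ℝ)) (n : ℤ) : Prop :=
  ∃ f : ℝ → ℝ, ContinuousOn f (Set.Icc 0 1) ∧
    (∀ t ∈ Set.Icc (0 : ℝ) 1, ((f t : ℝ) : AddCircle (1 : ℝ)) = ℓ t) ∧ f 1 - f 0 = n

/-- The loop which runs once around the boundary of the square `[-1, 1]²`, the unit sphere of
`Fin 2 → ℝ` (with the supremum norm), for `t` from `0` to `1`. -/
def squareLoop (t : ℝ) : Fin 2 → ℝ :=
  ‖![Real.cos (2 * Real.pi * t), Real.sin (2 * Real.pi * t)]‖⁻¹ •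
    ![Real.cos (2 * Real.pi * t), Real.sin (2 * Real.pi * t)]

section Incidence

open scoped Classical

variable {X : Type*} [TopologicalSpace X] (C : Set X) [CWComplex C]

/-- The number of ends (`0`, `1` or `2`) of the one-cell `e` which lie at the zero-cell `v`,
that is, the number of links (oriented edges) over `e` which start at `v`. -/
def endCount (e : cell C 1) (v : cell C 0) : ℕ :=
  (if map 1 e (fun _ => -1) ∈ closedCell 0 v then 1 else 0) +
    (if map 1 e (fun _ => 1) ∈ closedCell 0 v then 1 else 0)

/-- The map from the one-skeleton to the circle `ℝ/ℤ` which collapses the complement of the open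
one-cell `e` to the point `0` and runs once around the circle along `e`. -/
def collapse (e : cell C 1) (x : X) : AddCircle (1 : ℝ) :=
  if x ∈ openCell 1 e then ((((map 1 e).symm x 0 + 1) / 2 : ℝ) : AddCircle (1 : ℝ)) else 0

/-- The loop in `ℝ/ℤ` obtained by composing the attaching map of the two-cell `p` with the collapse
of the one-skeleton onto the one-cell `e`. -/
def attachingLoop (p : cell C 2) (e : cell C 1) (t : ℝ) : AddCircle (1 : ℝ) :=
  collapse C e (map 2 p (squareLoop t))

/-- The incidence number of the two-cell `p` and the one-cell `e`: the signed number of times that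
the boundary of `p` runs along `e`, that is, the degree of the loop above. -/
def windingCount (p : cell C 2) (e : cell C 1) : ℤ :=
  if h : ∃ n : ℤ, HasWindingNumber (attachingLoop C p e) n then h.choose else 0

end Incidence

/-! ### Cellular homology with `ℤ/2` coefficients in degrees zero and one -/

section Homology

variable {X : Type*} [TopologicalSpace X] (C : Set X) [CWComplex C] [CWComplex.Finite C]

/-- A finite CW complex has finitely many cells in each dimension. -/
@[reducible]
def fintypeCell (n : ℕ) : Fintype (cell C n) :=
  @Fintype.ofFinite _ (FiniteType.finite_cell n)

attribute [local instance] fintypeCell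

/-- The cellular boundary operator `C₁ → C₀` with coefficients in `ℤ/2`. -/
def boundary₁ : (cell C 1 → ZMod 2) →ₗ[ZMod 2] (cell C 0 → ZMod 2) :=
  (Matrix.of fun v e => (endCount C e v : ZMod 2)).mulVecLin

/-- The cellular boundary operator `C₂ → C₁` with coefficients in `ℤ/2`. -/
def boundary₂ : (cell C 2 → ZMod 2) →ₗ[ZMod 2] (cell C 1 → ZMod 2) :=
  (Matrix.of fun e p => (windingCount C p e : ZMod 2)).mulVecLin

/-- The Betti number `b₀ = dim H₀(-; ℤ/2)`. -/
def betti₀ : ℕ :=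
  Module.finrank (ZMod 2) ((cell C 0 → ZMod 2) ⧸ LinearMap.range (boundary₁ C))

/-- The Betti number `b₁ = dim H₁(-; ℤ/2)`, where `H₁` is one-cycles modulo boundaries. -/
def betti₁ : ℕ :=
  Module.finrank (ZMod 2) (LinearMap.ker (boundary₁ C) ⧸
    (LinearMap.range (boundary₂ C)).comap (LinearMap.ker (boundary₁ C)).subtype)

end Homology

/-! ### The toric code relative to a boundary subcomplex -/

section Lattice

variable {X : Type*} [TopologicalSpace X] [T2Space X] {C : Set X} [CWComplex C]
  [CWComplex.Finite C] (A : Subcomplex C)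

/-- The number `b₁^NT` of independent one-cycles of the subcomplex `A` modulo those which are
boundaries in the whole complex, that is, the rank of the map `H₁(A) → H₁(C)` induced by the
inclusion. It is computed as the dimension of the image of the one-cycles of `A`, extended
by zero to one-chains of the whole complex, in one-chains modulo boundaries. -/
def betti₁NT : ℕ :=
  Module.finrank (ZMod 2)
    (((LinearMap.ker (boundary₁ (A : Set X))).map
      (Function.ExtendByZero.linearMap (ZMod 2) (Subtype.val : A.I 1 → cell C 1))).map
        (LinearMap.range (boundary₂ C)).mkQ)

/-- The `n`-cells which are not in the boundary subcomplex: sites carrying a star term for `n = 0`,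
edges carrying a qubit for `n = 1`, plaquettes for `n = 2`. -/
def BulkCell (n : ℕ) : Type _ := {i : cell C n // i ∉ A.I n}

instance (n : ℕ) : Fintype (BulkCell A n) :=
  @Fintype.ofFinite _ (@Subtype.finite _ (FiniteType.finite_cell n) _)

instance (n : ℕ) : DecidableEq (BulkCell A n) := Classical.decEq _

/-- The star operator at the site `v`: the product of `X` over all links starting at `v`. -/
def starOp (v : BulkCell A 0) : Module.End ℂ (QubitSpace (BulkCell A 1)) :=
  xString fun e => endCount C e.1 v.1

/-- The plaquette operator `Z(p)`: the product of `Z` along the boundary of the two-cell `p`, with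
the identity in place of `Z` on edges of the boundary subcomplex. As `Z² = 1`, only the parity of
the number of times that the boundary of `p` runs along an edge matters. -/
def plaquetteOp (p : BulkCell A 2) : Module.End ℂ (QubitSpace (BulkCell A 1)) :=
  zString fun e => (windingCount C p.1 e.1).natAbs

/-- The toric-code Hamiltonian `H = -(1/g²) ∑_p Z(p) - λ ∑_v ∏ X`. -/
def hamiltonian (g lam : ℝ) : Module.End ℂ (QubitSpace (BulkCell A 1)) :=
  -((1 / g ^ 2 : ℝ) : ℂ) • ∑ p, plaquetteOp A p - (lam : ℂ) • ∑ v, starOp A v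

end Lattice

end ToricCode

end

/-!
The Hamiltonian is a sum of commuting involutions with negative weights: plaquette operators, which
are diagonal, and star operators, which translate configurations of the edges. As these operators
are unitary, the excess energy of an eigenstate over `-(1/g²) #plaquettes - λ #sites` is a weighted
sum of the defects `‖T ψ - ψ‖²` (`sub_groundEnergy_mul_norm_sq`). So the ground states are the states
fixed by all of the operators, as soon as one such state exists. A state is fixed by the plaquettes
iff it is supported on the relative cocycles `Z¹(C, A; ℤ/2)`, and by the stars iff it is invariant
under translation by the relative coboundaries `B¹(C, A; ℤ/2)`; since `B¹ ⊆ Z¹`, the ground states are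
the functions on `H¹(C, A; ℤ/2)` (`codeSpaceEquiv`, `mem_codeSpace_iff`), and the degeneracy is
`2 ^ dim H¹(C, A)`. This dimension is computed from the long exact sequence of the pair
(`finrank_relative_cycles`), using `H₀(C) = ℤ/2` for connected `C`.

The topological input concerns the cellular chain complex, whose incidence numbers are winding
numbers of attaching maps: `∂₁ ∂₂ = 0`, the value of `H₀` of a connected complex, and the vanishing
of `H₁` of a ball. All of it is obtained from Alexander–Spanier one-cochains, that is, functions of
pairs of nearby points, which are an elementary substitute for double covers. A cellular one-cochain
`c` defines an Alexander–Spanier cocycle on the one-skeleton (`edgeCocycle`), by pulling back a fixed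
cocycle of the circle along the collapse onto each edge; its holonomy around a two-cell `p` is
`∑ e, c e * [p : e]` (`exists_isLocPrimitive_attaching`). If `c` is a coboundary, the cocycle has a
primitive, and so the holonomy vanishes, which is `∂₁ ∂₂ = 0`. If conversely `c` is a cellular
cocycle, then the cocycle extends over the two-cells because its holonomy vanishes, and over the cells
of dimension at least three because their boundary spheres carry no nontrivial cocycles
(`IsLocCocycle.exists_extension`, `IsLocCocycle.exists_isLocPrimitive_sphere`). On a ball every
Alexander–Spanier cocycle has a primitive, by contraction and a Lebesgue number argument
(`IsLocCocycle.exists_isLocPrimitive_of_contraction`), and the values of this primitive on the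
vertices show that `c` is a cellular coboundary. Hence `b₁ = 0` for a ball, and if moreover the
boundary sphere is connected or empty, then the formulas for the degeneracy give `1`.
-/

noncomputable section

namespace ToricCode

section Cochains

open Set Filter Topology

/-! ### Alexander–Spanier one-cocycles with `ℤ/2` coefficients -/

section AlexanderSpanier

variable {X Y : Type*} [TopologicalSpace X] [TopologicalSpace Y]

/-- An Alexander–Spanier one-cocycle on `S`: a function of pairs of points which satisfies the
cocycle identity for all triples of points of `S` which are close to one another. Values at pairs
of points which are far apart are irrelevant. -/
def IsLocCocycle (S : Set X) (φ : X → X → ZMod 2) : Prop :=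
  ∀ z ∈ S, ∃ U ∈ 𝓝[S] z, ∀ x ∈ U, ∀ y ∈ U, ∀ w ∈ U, φ x y + φ y w = φ x w

/-- The (not necessarily continuous) function `f` is a primitive of the Alexander–Spanier
one-cochain `φ` on `S`: `φ` is the coboundary of `f` near the diagonal of `S`. -/
def IsLocPrimitive (S : Set X) (φ : X → X → ZMod 2) (f : X → ZMod 2) : Prop :=
  ∀ z ∈ S, ∃ U ∈ 𝓝[S] z, ∀ x ∈ U, ∀ y ∈ U, φ x y = f x + f y

theorem zmod_two_add_eq_zero_iff {a b : ZMod 2} : a + b = 0 ↔ a = b := by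
  revert a b; decide

theorem zmod_two_eq_add_iff {a b c : ZMod 2} : a = b + c ↔ a + b = c := by
  revert a b c; decide

theorem IsLocCocycle.mono {S T : Set X} {φ : X → X → ZMod 2} (h : IsLocCocycle S φ)
    (hT : T ⊆ S) : IsLocCocycle T φ := fun z hz =>
  let ⟨U, hU, hφ⟩ := h z (hT hz)
  ⟨U, nhdsWithin_mono z hT hU, hφ⟩

theorem IsLocPrimitive.mono {S T : Set X} {φ : X → X → ZMod 2} {f : X → ZMod 2}
    (h : IsLocPrimitive S φ f) (hT : T ⊆ S) : IsLocPrimitive T φ f := fun z hz =>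
  let ⟨U, hU, hφ⟩ := h z (hT hz)
  ⟨U, nhdsWithin_mono z hT hU, hφ⟩

theorem IsLocPrimitive.congr {S : Set X} {φ ψ : X → X → ZMod 2} {f g : X → ZMod 2}
    (h : IsLocPrimitive S φ f) (hφ : ∀ x ∈ S, ∀ y ∈ S, ψ x y = φ x y)
    (hf : ∀ x ∈ S, g x = f x) : IsLocPrimitive S ψ g := fun z hz => by
  obtain ⟨U, hU, hc⟩ := h z hz
  refine ⟨U ∩ S, inter_mem hU self_mem_nhdsWithin, fun x hx y hy => ?_⟩
  rw [hφ x hx.2 y hy.2, hf x hx.2, hf y hy.2, hc x hx.1 y hy.1]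

theorem IsLocCocycle.comap {S : Set X} {φ : X → X → ZMod 2} (h : IsLocCocycle S φ)
    {T : Set Y} {g : Y → X} (hg : ContinuousOn g T) (hm : MapsTo g T S) :
    IsLocCocycle T fun x y => φ (g x) (g y) := fun z hz => by
  obtain ⟨U, hU, hc⟩ := h (g z) (hm hz)
  exact ⟨g ⁻¹' U, (hg z hz).tendsto_nhdsWithin hm hU, fun x hx y hy w hw => hc _ hx _ hy _ hw⟩

theorem IsLocPrimitive.comap {S : Set X} {φ : X → X → ZMod 2} {f : X → ZMod 2}
    (h : IsLocPrimitive S φ f) {T : Set Y} {g : Y → X} (hg : ContinuousOn g T)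
    (hm : MapsTo g T S) : IsLocPrimitive T (fun x y => φ (g x) (g y)) fun x => f (g x) :=
  fun z hz => by
  obtain ⟨U, hU, hc⟩ := h (g z) (hm hz)
  exact ⟨g ⁻¹' U, (hg z hz).tendsto_nhdsWithin hm hU, fun x hx y hy => hc _ hx _ hy⟩

theorem IsLocCocycle.sum {ι : Type*} (s : Finset ι) {S : Set X} {φ : ι → X → X → ZMod 2}
    (c : ι → ZMod 2) (h : ∀ i ∈ s, IsLocCocycle S (φ i)) :
    IsLocCocycle S fun x y => ∑ i ∈ s, c i * φ i x y := fun z hz => by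
  have h' : ∀ i : s, ∃ U ∈ 𝓝[S] z, ∀ x ∈ U, ∀ y ∈ U, ∀ w ∈ U, φ i x y + φ i y w = φ i x w :=
    fun i => h i i.2 z hz
  choose U hU hc using h'
  refine ⟨⋂ i, U i, Filter.iInter_mem.2 hU, fun x hx y hy w hw => ?_⟩
  rw [mem_iInter] at hx hy hw
  rw [← Finset.sum_add_distrib]
  refine Finset.sum_congr rfl fun i hi => ?_
  rw [← mul_add, hc ⟨i, hi⟩ x (hx _) y (hy _) w (hw _)]

theorem IsLocPrimitive.sum {ι : Type*} (s : Finset ι) {S : Set X} {φ : ι → X → X → ZMod 2}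
    {f : ι → X → ZMod 2} (c : ι → ZMod 2) (h : ∀ i ∈ s, IsLocPrimitive S (φ i) (f i)) :
    IsLocPrimitive S (fun x y => ∑ i ∈ s, c i * φ i x y) fun x => ∑ i ∈ s, c i * f i x :=
  fun z hz => by
  have h' : ∀ i : s, ∃ U ∈ 𝓝[S] z, ∀ x ∈ U, ∀ y ∈ U, φ i x y = f i x + f i y :=
    fun i => h i i.2 z hz
  choose U hU hc using h'
  refine ⟨⋂ i, U i, Filter.iInter_mem.2 hU, fun x hx y hy => ?_⟩
  rw [mem_iInter] at hx hy
  rw [← Finset.sum_add_distrib]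
  refine Finset.sum_congr rfl fun i hi => ?_
  rw [← mul_add, hc ⟨i, hi⟩ x (hx _) y (hy _)]

/-- Two primitives of the same cochain differ by a constant on connected sets. -/
theorem IsLocPrimitive.add_eq_add {S : Set X} (hS : IsPreconnected S) {φ : X → X → ZMod 2}
    {f g : X → ZMod 2} (hf : IsLocPrimitive S φ f) (hg : IsLocPrimitive S φ g) {x y : X}
    (hx : x ∈ S) (hy : y ∈ S) : f x + g x = f y + g y := by
  refine hS.induction₂ (fun x y => f x + g x = f y + g y) (fun z hz => ?_)
    (fun _ _ _ _ _ _ h h' => h.trans h') (fun _ _ _ _ h => h.symm) hx hy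
  obtain ⟨U, hU, h⟩ := hf z hz
  obtain ⟨V, hV, h'⟩ := hg z hz
  filter_upwards [hU, hV] with y hy hy'
  have h1 := h z (mem_of_mem_nhdsWithin hz hU) y hy
  rw [h' z (mem_of_mem_nhdsWithin hz hV) y hy'] at h1
  revert h1
  generalize f z = a, g z = b, f y = c, g y = d
  revert a b c d
  decide

/-- For a cocycle it suffices to check the defining identity of a primitive at pairs of points
one of which is fixed. -/
theorem IsLocCocycle.isLocPrimitive {S : Set X} {φ : X → X → ZMod 2} (h : IsLocCocycle S φ)
    {f : X → ZMod 2} (hf : ∀ z ∈ S, ∀ᶠ x in 𝓝[S] z, φ x z = f x + f z) :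
    IsLocPrimitive S φ f := fun z hz => by
  obtain ⟨U, hU, hc⟩ := h z hz
  refine ⟨U ∩ {x | φ x z = f x + f z}, inter_mem hU (hf z hz), fun x hx y hy => ?_⟩
  have hzU := mem_of_mem_nhdsWithin hz hU
  have h1 := hc x hx.1 z hzU y hy.1
  have h2 := hc z hzU y hy.1 z hzU
  have h3 := hc z hzU z hzU z hzU
  have h4 : φ x z = f x + f z := hx.2
  have h5 : φ y z = f y + f z := hy.2
  rw [h5] at h2
  rw [h4] at h1
  rw [← h1]
  revert h2 h3
  generalize φ z z = a, φ z y = b, f x = c, f y = d, f z = e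
  revert a b c d e
  decide

/-- A continuous map from a compact set to a Hausdorff space is closed, so that neighbourhoods in
its image can be recognised upstairs. -/
theorem mem_nhdsWithin_image [T2Space X] {K : Set Y} (hK : IsCompact K) {γ : Y → X}
    (hγ : ContinuousOn γ K) {z : X} {V : Set X}
    (h : ∀ t ∈ K, γ t = z → γ ⁻¹' V ∈ 𝓝[K] t) : V ∈ 𝓝[γ '' K] z := by
  have h' : ∀ t : Y, ∃ O : Set Y, IsOpen O ∧ (t ∈ K → γ t = z → t ∈ O ∧ O ∩ K ⊆ γ ⁻¹' V) := by
    intro t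
    by_cases ht : t ∈ K ∧ γ t = z
    · obtain ⟨O, hO, htO, hOV⟩ := mem_nhdsWithin.1 (h t ht.1 ht.2)
      exact ⟨O, hO, fun _ _ => ⟨htO, hOV⟩⟩
    · exact ⟨∅, isOpen_empty, fun h1 h2 => (ht ⟨h1, h2⟩).elim⟩
  choose O hO hOV using h'
  set W : Set Y := ⋃ t ∈ K ∩ γ ⁻¹' {z}, O t with hW
  have hWo : IsOpen W := isOpen_biUnion fun t _ => hO t
  have hcl : IsClosed (γ '' (K \ W)) :=
    ((hK.diff hWo).image_of_continuousOn (hγ.mono sdiff_subset)).isClosed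
  have hz : z ∉ γ '' (K \ W) := by
    rintro ⟨t, ⟨htK, htW⟩, rfl⟩
    exact htW (mem_biUnion (⟨htK, rfl⟩ : t ∈ K ∩ γ ⁻¹' {γ t}) (hOV t htK rfl).1)
  refine mem_nhdsWithin.2 ⟨_, hcl.isOpen_compl, hz, ?_⟩
  rintro _ ⟨hx, t, htK, rfl⟩
  have htW : t ∈ W := by
    by_contra htW
    exact hx ⟨t, ⟨htK, htW⟩, rfl⟩
  obtain ⟨s, ⟨hsK, hs⟩, hts⟩ := mem_iUnion₂.1 htW
  exact (hOV s hsK hs).2 ⟨hts, htK⟩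

/-- Primitives descend along continuous images of compact sets. -/
theorem IsLocCocycle.isLocPrimitive_image [T2Space X] {K : Set Y} (hK : IsCompact K) {γ : Y → X}
    (hγ : ContinuousOn γ K) {φ : X → X → ZMod 2} (h : IsLocCocycle (γ '' K) φ) {f : X → ZMod 2}
    (hf : IsLocPrimitive K (fun s t => φ (γ s) (γ t)) fun t => f (γ t)) :
    IsLocPrimitive (γ '' K) φ f := by
  refine h.isLocPrimitive fun z _ => mem_nhdsWithin_image hK hγ ?_
  rintro t ht rfl
  obtain ⟨U, hU, hc⟩ := hf t ht
  filter_upwards [hU] with s hs using hc s hs t (mem_of_mem_nhdsWithin ht hU)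

/-- A Mayer–Vietoris argument: a cocycle with primitives on two closed sets with connected
intersection has a primitive on their union. -/
theorem IsLocCocycle.exists_isLocPrimitive_union {P Q : Set X} (hP : IsClosed P) (hQ : IsClosed Q)
    (hPQ : IsPreconnected (P ∩ Q)) {φ : X → X → ZMod 2} (h : IsLocCocycle (P ∪ Q) φ)
    {f g : X → ZMod 2} (hf : IsLocPrimitive P φ f) (hg : IsLocPrimitive Q φ g) :
    ∃ F, IsLocPrimitive (P ∪ Q) φ F := by
  classical
  obtain ⟨k, hk⟩ : ∃ k, ∀ x ∈ P ∩ Q, f x + g x = k := by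
    rcases (P ∩ Q).eq_empty_or_nonempty with he | ⟨x₀, hx₀⟩
    · exact ⟨0, by simp [he]⟩
    · exact ⟨f x₀ + g x₀, fun x hx => (hf.mono inter_subset_left).add_eq_add hPQ
        (hg.mono inter_subset_right) hx hx₀⟩
  set F : X → ZMod 2 := fun x => if x ∈ P then f x else g x + k with hF
  have hFP : ∀ x ∈ P, F x = f x := fun x hx => if_pos hx
  have hFQ : ∀ x ∈ Q, F x = g x + k := fun x hx => by
    by_cases hxP : x ∈ P
    · rw [hFP x hxP, zmod_two_eq_add_iff, hk x ⟨hxP, hx⟩]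
    · exact if_neg hxP
  have h1 : IsLocPrimitive P φ F := hf.congr (fun _ _ _ _ => rfl) hFP
  have h2 : IsLocPrimitive Q φ F := fun z hz => by
    obtain ⟨U, hU, hc⟩ := hg z hz
    refine ⟨U ∩ Q, inter_mem hU self_mem_nhdsWithin, fun x hx y hy => ?_⟩
    have e : ∀ a b c : ZMod 2, a + b = a + c + (b + c) := by decide
    rw [hc x hx.1 y hy.1, hFQ x hx.2, hFQ y hy.2, e _ _ k]
  have key : ∀ R : Set X, IsClosed R → IsLocPrimitive R φ F → ∀ z,
      ∀ᶠ x in 𝓝[R] z, φ x z = F x + F z := fun R hR hRF z => by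
    by_cases hz : z ∈ R
    · obtain ⟨U, hU, hc⟩ := hRF z hz
      filter_upwards [hU] with x hx using hc x hx z (mem_of_mem_nhdsWithin hz hU)
    · have : 𝓝[R] z = ⊥ := by
        rwa [← notMem_closure_iff_nhdsWithin_eq_bot, hR.closure_eq]
      simp [this]
  refine ⟨F, h.isLocPrimitive fun z _ => ?_⟩
  rw [nhdsWithin_union, eventually_sup]
  exact ⟨key P hP h1 z, key Q hQ h2 z⟩

end AlexanderSpanier

/-- Alexander–Spanier one-cocycles on a compact contractible metric space have primitives: sum the
cocycle along the tracks of the contraction, subdivided finely. -/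
theorem IsLocCocycle.exists_isLocPrimitive_of_contraction {Y : Type*} [PseudoMetricSpace Y]
    {T : Set Y} (hT : IsCompact T) {H : ℝ × Y → Y} (hH : ContinuousOn H (Icc 0 1 ×ˢ T))
    (hm : MapsTo H (Icc 0 1 ×ˢ T) T) {x₀ : Y} (h0 : ∀ x ∈ T, H (0, x) = x₀)
    (h1 : ∀ x ∈ T, H (1, x) = x) {φ : Y → Y → ZMod 2} (h : IsLocCocycle T φ) :
    ∃ f, IsLocPrimitive T φ f := by
  set K : Set (ℝ × Y) := Icc 0 1 ×ˢ T with hKdef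
  have hK : IsCompact K := isCompact_Icc.prod hT
  set ψ : ℝ × Y → ℝ × Y → ZMod 2 := fun p q => φ (H p) (H q) with hψ
  have hc : IsLocCocycle K ψ := h.comap hH hm
  choose U hU hUc using hc
  obtain ⟨V, hV, hVU⟩ := lebesgue_number_lemma_nhdsWithin' hK hU
  obtain ⟨ε, hε, hεV⟩ := Metric.mem_uniformity_dist.1 hV
  -- the cocycle identity holds for triples of points in a ball of radius `ε`
  have key : ∀ p ∈ K, ∀ x ∈ K, ∀ y ∈ K, ∀ w ∈ K, dist p x < ε → dist p y < ε → dist p w < ε →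
      ψ x y + ψ y w = ψ x w := by
    intro p hp x hx y hy w hw hpx hpy hpw
    obtain ⟨q, hq⟩ := hVU p hp
    exact hUc _ _ x (hq ⟨hεV hpx, hx⟩) y (hq ⟨hεV hpy, hy⟩) w (hq ⟨hεV hpw, hw⟩)
  obtain ⟨N, hN⟩ := exists_nat_one_div_lt hε
  set τ : ℕ → ℝ := fun j => j / ((N : ℝ) + 1) with hτ
  have hN0 : (0 : ℝ) < (N : ℝ) + 1 := by positivity
  have hτmem : ∀ j ≤ N + 1, τ j ∈ Icc (0 : ℝ) 1 := fun j hj =>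
    ⟨by positivity, by rw [hτ, div_le_one hN0]; exact_mod_cast hj⟩
  have hτd : ∀ j, dist (τ j) (τ (j + 1)) < ε := fun j => by
    have : τ j - τ (j + 1) = -(1 / ((N : ℝ) + 1)) := by
      simp only [hτ]; push_cast; ring
    rw [Real.dist_eq, this, abs_neg, abs_of_pos (by positivity)]
    exact hN
  set f : ℕ → Y → ZMod 2 := fun j x => ∑ i ∈ Finset.range j, ψ (τ i, x) (τ (i + 1), x) with hf
  have hstep : ∀ x ∈ T, ∀ y ∈ T, dist x y < ε → ∀ j ≤ N + 1,
      f j x + ψ (τ j, x) (τ j, y) = f j y := by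
    intro x hx y hy hxy j
    induction j with
    | zero =>
      intro _
      have e1 : H (τ 0, x) = x₀ := by simp [hτ, h0 x hx]
      have e2 : H (τ 0, y) = x₀ := by simp [hτ, h0 y hy]
      have hx0 : (τ 0, x) ∈ K := ⟨hτmem 0 (by omega), hx⟩
      have := key _ hx0 _ hx0 _ hx0 _ hx0 (by simpa) (by simpa) (by simpa)
      simpa [hf, hψ, e1, e2] using this
    | succ j ih =>
      intro hj
      have ih' := ih (by omega)
      have m1 : (τ j, x) ∈ K := ⟨hτmem j (by omega), hx⟩
      have m2 : (τ (j + 1), x) ∈ K := ⟨hτmem _ hj, hx⟩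
      have m3 : (τ j, y) ∈ K := ⟨hτmem j (by omega), hy⟩
      have m4 : (τ (j + 1), y) ∈ K := ⟨hτmem _ hj, hy⟩
      have d1 : dist (τ j, x) (τ j, x) < ε := by simpa
      have d2 : dist (τ j, x) (τ (j + 1), x) < ε := by
        rw [Prod.dist_eq]; simpa [hε] using hτd j
      have d3 : dist (τ j, x) (τ j, y) < ε := by
        rw [Prod.dist_eq]; simpa [hε] using hxy
      have d4 : dist (τ j, x) (τ (j + 1), y) < ε := by
        rw [Prod.dist_eq]; exact max_lt (hτd j) hxy
      have c1 := key _ m1 _ m1 _ m2 _ m4 d1 d2 d4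
      have c2 := key _ m1 _ m1 _ m3 _ m4 d1 d3 d4
      have s1 : f (j + 1) x = f j x + ψ (τ j, x) (τ (j + 1), x) := Finset.sum_range_succ _ _
      have s2 : f (j + 1) y = f j y + ψ (τ j, y) (τ (j + 1), y) := Finset.sum_range_succ _ _
      rw [s1, s2, ← ih', add_assoc, c1, ← c2, add_assoc]
  refine ⟨f (N + 1), fun z hz => ⟨Metric.ball z (ε / 2) ∩ T,
    inter_mem (mem_nhdsWithin_of_mem_nhds (Metric.ball_mem_nhds z (half_pos hε)))
      self_mem_nhdsWithin, fun x hx y hy => ?_⟩⟩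
  have hxy : dist x y < ε := by
    have := dist_triangle_right x y z
    have h2 := Metric.mem_ball.1 hx.1
    have h3 := Metric.mem_ball.1 hy.1
    linarith
  have := hstep x hx.2 y hy.2 hxy (N + 1) le_rfl
  have e : τ (N + 1) = 1 := by simp only [hτ]; push_cast; exact div_self hN0.ne'
  simp only [hψ, e, h1 x hx.2, h1 y hy.2] at this
  rw [zmod_two_eq_add_iff, add_comm, this]

/-- Alexander–Spanier one-cocycles on the boundary of the cube `[-1, 1]ⁿ` have primitives when
`n ≥ 3`, as this boundary is the union of two contractible halves with connected intersection. -/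
theorem IsLocCocycle.exists_isLocPrimitive_sphere (n : ℕ) {φ : (Fin (n + 3) → ℝ) →
    (Fin (n + 3) → ℝ) → ZMod 2} (h : IsLocCocycle (Metric.sphere 0 1) φ) :
    ∃ f, IsLocPrimitive (Metric.sphere 0 1) φ f := by
  -- each half contracts radially to the pole `σ • e₀`
  have half : ∀ σ : ℝ, |σ| = 1 → ∃ f, IsLocPrimitive
      (Metric.sphere (0 : Fin (n + 3) → ℝ) 1 ∩ {x | 0 ≤ σ * x 0}) φ f := by
    intro σ hσ
    have hσ2 : σ * σ = 1 := by rw [← abs_mul_abs_self, hσ, one_mul]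
    set T := Metric.sphere (0 : Fin (n + 3) → ℝ) 1 ∩ {x | 0 ≤ σ * x 0} with hT
    set G : ℝ × (Fin (n + 3) → ℝ) → (Fin (n + 3) → ℝ) :=
      fun p => (1 - p.1) • Pi.single 0 σ + p.1 • p.2 with hG
    have hG0 : ∀ p ∈ Icc (0 : ℝ) 1 ×ˢ T, 0 ≤ σ * G p 0 ∧ G p ≠ 0 := by
      rintro ⟨t, x⟩ ⟨ht, hx, hx0⟩
      have hx0' : 0 ≤ σ * x 0 := hx0
      have e : σ * G (t, x) 0 = (1 - t) + t * (σ * x 0) := by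
        simp only [hG, Pi.add_apply, Pi.smul_apply, Pi.single_eq_same, smul_eq_mul]
        linear_combination (1 - t) * hσ2
      have ht1 : 0 ≤ t * (σ * x 0) := mul_nonneg ht.1 hx0'
      refine ⟨by rw [e]; linarith [ht.2], fun h0 => ?_⟩
      rw [h0] at e
      have ht' : t = 1 := by
        have := ht.2
        simp only [Pi.zero_apply, mul_zero] at e
        linarith
      subst ht'
      simp only [hG, sub_self, zero_smul, one_smul, zero_add] at h0
      simp [h0] at hx
    have hGc : Continuous G := by fun_prop
    refine (h.mono inter_subset_left).exists_isLocPrimitive_of_contraction (T := T)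
      ((isCompact_sphere _ _).inter_right ?_) (H := fun p => ‖G p‖⁻¹ • G p)
      (x₀ := ‖(Pi.single 0 σ : Fin (n + 3) → ℝ)‖⁻¹ • Pi.single 0 σ) ?_ ?_ ?_ ?_
    · exact isClosed_le continuous_const (by fun_prop)
    · exact (hGc.norm.continuousOn.inv₀ fun p hp => norm_ne_zero_iff.2 (hG0 p hp).2).smul
        hGc.continuousOn
    · intro p hp
      refine ⟨?_, ?_⟩
      · rw [mem_sphere_zero_iff_norm, norm_smul, norm_inv, norm_norm]
        exact inv_mul_cancel₀ (norm_ne_zero_iff.2 (hG0 p hp).2)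
      · have := mul_nonneg (inv_nonneg.2 (norm_nonneg (G p))) (hG0 p hp).1
        simp only [mem_ofPred_eq, Pi.smul_apply, smul_eq_mul]
        linarith
    · intro x _
      simp [hG]
    · intro x hx
      have := mem_sphere_zero_iff_norm.1 hx.1
      simp [hG, this]
  obtain ⟨f, hf⟩ := half 1 (by simp)
  obtain ⟨g, hg⟩ := half (-1) (by simp)
  have hcl : ∀ σ : ℝ, IsClosed (Metric.sphere (0 : Fin (n + 3) → ℝ) 1 ∩ {x | 0 ≤ σ * x 0}) :=
    fun σ => Metric.isClosed_sphere.inter (isClosed_le continuous_const (by fun_prop))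
  have hunion : (Metric.sphere (0 : Fin (n + 3) → ℝ) 1 ∩ {x | 0 ≤ 1 * x 0}) ∪
      (Metric.sphere (0 : Fin (n + 3) → ℝ) 1 ∩ {x | 0 ≤ -1 * x 0}) = Metric.sphere 0 1 := by
    rw [← inter_union_distrib_left, inter_eq_left]
    intro x _
    rcases le_total 0 (x 0) with h | h
    · left; simpa using h
    · right; simpa using h
  have hnorm : ∀ y : Fin (n + 2) → ℝ, ‖(Fin.cons 0 y : Fin (n + 3) → ℝ)‖ = ‖y‖ := fun y => by
    refine le_antisymm ((pi_norm_le_iff_of_nonneg (norm_nonneg _)).2 fun i => ?_)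
      ((pi_norm_le_iff_of_nonneg (norm_nonneg _)).2 fun i => ?_)
    · refine Fin.cases (by simp) (fun i => ?_) i
      simpa using norm_le_pi_norm y i
    · simpa using norm_le_pi_norm (Fin.cons 0 y : Fin (n + 3) → ℝ) i.succ
  -- the equator is a sphere of one dimension less
  have hinter : (Metric.sphere (0 : Fin (n + 3) → ℝ) 1 ∩ {x | 0 ≤ 1 * x 0}) ∩
      (Metric.sphere (0 : Fin (n + 3) → ℝ) 1 ∩ {x | 0 ≤ -1 * x 0}) =
      (fun y : Fin (n + 2) → ℝ => (Fin.cons 0 y : Fin (n + 3) → ℝ)) '' Metric.sphere 0 1 := by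
    ext x
    constructor
    · rintro ⟨⟨hx, h1⟩, -, h2⟩
      have hx0 : x 0 = 0 := by
        simp only [mem_ofPred_eq] at h1 h2
        linarith
      have hxc : (Fin.cons 0 (fun i => x i.succ) : Fin (n + 3) → ℝ) = x := by
        rw [← hx0]; exact Fin.cons_self_tail x
      refine ⟨fun i => x i.succ, ?_, hxc⟩
      rw [mem_sphere_zero_iff_norm] at hx ⊢
      rw [← hnorm, hxc, hx]
    · rintro ⟨y, hy, rfl⟩
      rw [mem_sphere_zero_iff_norm] at hy
      simp [hnorm, hy]
  have hconn : IsPreconnected (Metric.sphere (0 : Fin (n + 2) → ℝ) 1) := by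
    refine isPreconnected_sphere ?_ 0 1
    rw [rank_fun', Fintype.card_fin]
    exact_mod_cast (by omega : 1 < n + 2)
  rw [← hunion] at h ⊢
  refine h.exists_isLocPrimitive_union (hcl 1) (hcl (-1)) ?_ hf hg
  rw [hinter]
  refine hconn.image _ (Continuous.continuousOn ?_)
  exact continuous_const.finCons continuous_id

/-! ### The connected double cover of the circle and winding numbers -/

/-- An Alexander–Spanier one-cocycle on the circle `ℝ/ℤ` which represents the generator of
`H¹(ℝ/ℤ; ℤ/2)`: with representatives in `[0, 1)`, it detects whether one has to pass through the
point `0` on the short way between two points. -/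
def circleCocycle (a b : AddCircle (1 : ℝ)) : ZMod 2 :=
  if |(AddCircle.equivIco (1 : ℝ) 0 a : ℝ) - AddCircle.equivIco (1 : ℝ) 0 b| < 1 / 2 then 0 else 1

/-- On `ℝ` the circle cocycle becomes the coboundary of the parity of the integral part. -/
theorem circleCocycle_coe {a b : ℝ} (h : |a - b| < 1 / 2) :
    circleCocycle (a : AddCircle (1 : ℝ)) (b : AddCircle (1 : ℝ)) =
      ((⌊a⌋ : ℤ) : ZMod 2) + ((⌊b⌋ : ℤ) : ZMod 2) := by
  have ea := AddCircle.coe_equivIco_mk_apply (1 : ℝ) a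
  have eb := AddCircle.coe_equivIco_mk_apply (1 : ℝ) b
  rw [div_one, mul_one] at ea eb
  unfold circleCocycle
  rw [ea, eb]
  have ha := Int.floor_add_fract a
  have hb := Int.floor_add_fract b
  have ha0 := Int.fract_nonneg a
  have hb0 := Int.fract_nonneg b
  have ha1 := Int.fract_lt_one a
  have hb1 := Int.fract_lt_one b
  rw [abs_lt] at h
  have h1 : (⌊a⌋ : ℝ) - ⌊b⌋ < 2 := by linarith
  have h2 : (⌊b⌋ : ℝ) - ⌊a⌋ < 2 := by linarith
  have h1' : ⌊a⌋ - ⌊b⌋ < 2 := by exact_mod_cast h1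
  have h2' : ⌊b⌋ - ⌊a⌋ < 2 := by exact_mod_cast h2
  have hz : ∀ x : ZMod 2, x + x = 0 ∧ x + (x + 1) = 1 ∧ x + 1 + x = 1 := by decide
  rcases (by omega : ⌊a⌋ = ⌊b⌋ ∨ ⌊a⌋ = ⌊b⌋ + 1 ∨ ⌊b⌋ = ⌊a⌋ + 1) with e | e | e
  · have e' : (⌊a⌋ : ℝ) = ⌊b⌋ := by rw [e]
    rw [if_pos (abs_lt.2 ⟨by linarith, by linarith⟩), e, (hz _).1]
  · have e' : (⌊a⌋ : ℝ) = ⌊b⌋ + 1 := by rw [e]; push_cast; ring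
    rw [if_neg (fun hc => by rw [abs_lt] at hc; linarith), e]
    push_cast
    rw [(hz _).2.2]
  · have e' : (⌊b⌋ : ℝ) = ⌊a⌋ + 1 := by rw [e]; push_cast; ring
    rw [if_neg (fun hc => by rw [abs_lt] at hc; linarith), e]
    push_cast
    rw [(hz _).2.1]

theorem isLocPrimitive_circleCocycle {Y : Type*} [TopologicalSpace Y] {T : Set Y} {g : Y → ℝ}
    (hg : ContinuousOn g T) {κ : Y → AddCircle (1 : ℝ)}
    (hκ : ∀ t ∈ T, κ t = (g t : AddCircle (1 : ℝ))) :
    IsLocPrimitive T (fun s t => circleCocycle (κ s) (κ t)) fun t => ((⌊g t⌋ : ℤ) : ZMod 2) := by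
  intro z hz
  refine ⟨g ⁻¹' Metric.ball (g z) (1 / 4) ∩ T, inter_mem ((hg z hz)
    (Metric.ball_mem_nhds _ (by norm_num))) self_mem_nhdsWithin, fun x hx y hy => ?_⟩
  simp only
  rw [hκ x hx.2, hκ y hy.2, circleCocycle_coe]
  have h1 : |g x - g z| < 1 / 4 := hx.1
  have h2 : |g y - g z| < 1 / 4 := hy.1
  rw [abs_lt] at *
  constructor <;> linarith

theorem isLocCocycle_circleCocycle : IsLocCocycle univ circleCocycle := by
  intro z _
  obtain ⟨r, rfl⟩ := QuotientAddGroup.mk_surjective z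
  refine ⟨(fun r : ℝ => (r : AddCircle (1 : ℝ))) '' Metric.ball r (1 / 4), ?_, ?_⟩
  · rw [nhdsWithin_univ]
    exact (QuotientAddGroup.isOpenMap_coe _ Metric.isOpen_ball).mem_nhds
      ⟨r, Metric.mem_ball_self (by norm_num), rfl⟩
  · rintro _ ⟨a, ha, rfl⟩ _ ⟨b, hb, rfl⟩ _ ⟨c, hc, rfl⟩
    have h1 : |a - r| < 1 / 4 := ha
    have h2 : |b - r| < 1 / 4 := hb
    have h3 : |c - r| < 1 / 4 := hc
    rw [abs_lt] at h1 h2 h3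
    rw [circleCocycle_coe (abs_lt.2 ⟨by linarith, by linarith⟩),
      circleCocycle_coe (abs_lt.2 ⟨by linarith, by linarith⟩),
      circleCocycle_coe (abs_lt.2 ⟨by linarith, by linarith⟩)]
    have hz : ∀ x y z : ZMod 2, x + y + (y + z) = x + z := by decide
    exact hz _ _ _

theorem exists_hasWindingNumber {ℓ : ℝ → AddCircle (1 : ℝ)} (hℓ : ContinuousOn ℓ (Icc 0 1))
    (h01 : ℓ 0 = ℓ 1) : ∃ n, HasWindingNumber ℓ n := by
  obtain ⟨r, hr⟩ := QuotientAddGroup.mk_surjective (ℓ 0)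
  set γ : C(unitInterval, AddCircle (1 : ℝ)) := ⟨fun t => ℓ t, hℓ.domRestrict⟩ with hγ
  have hγ0 : γ 0 = (r : AddCircle (1 : ℝ)) := hr.symm
  set cov := AddCircle.isCoveringMap_coe (1 : ℝ)
  set Γ := cov.liftPath γ r hγ0 with hΓ
  have hlift : ∀ t : unitInterval, ((Γ t : ℝ) : AddCircle (1 : ℝ)) = ℓ t := fun t =>
    congrFun (cov.liftPath_lifts γ r hγ0) t
  have hends : ((Γ 1 - Γ 0 : ℝ) : AddCircle (1 : ℝ)) = 0 := by
    rw [AddCircle.coe_sub, hlift, hlift]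
    simp [h01]
  obtain ⟨n, hn⟩ := (AddCircle.coe_eq_zero_iff _).1 hends
  have hext : ∀ (t : ℝ) (ht : t ∈ Icc (0 : ℝ) 1),
      IccExtend (zero_le_one' ℝ) Γ t = Γ ⟨t, ht⟩ := fun t ht => IccExtend_of_mem _ _ ht
  refine ⟨n, IccExtend (zero_le_one' ℝ) Γ, (Γ.continuous.Icc_extend').continuousOn,
    fun t ht => ?_, ?_⟩
  · rw [hext t ht, hlift]
  · rw [hext 1 (by simp), hext 0 (by simp)]
    simp only [zsmul_eq_mul, mul_one] at hn
    rw [hn]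
    rfl

theorem cos_sin_ne_zero (t : ℝ) :
    ![Real.cos (2 * Real.pi * t), Real.sin (2 * Real.pi * t)] ≠ 0 := by
  intro h
  have h0 : Real.cos (2 * Real.pi * t) = 0 := by simpa using congrFun h 0
  have h1 : Real.sin (2 * Real.pi * t) = 0 := by simpa using congrFun h 1
  have := Real.sin_sq_add_cos_sq (2 * Real.pi * t)
  rw [h0, h1] at this
  norm_num at this

theorem continuous_squareLoop : Continuous squareLoop := by
  have hc : Continuous fun t : ℝ => ![Real.cos (2 * Real.pi * t), Real.sin (2 * Real.pi * t)] := by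
    refine continuous_pi fun i => ?_
    fin_cases i
    · exact Real.continuous_cos.comp (continuous_const.mul continuous_id)
    · exact Real.continuous_sin.comp (continuous_const.mul continuous_id)
  exact (hc.norm.inv₀ fun t => norm_ne_zero_iff.2 (cos_sin_ne_zero t)).smul hc

theorem squareLoop_mem_sphere (t : ℝ) : squareLoop t ∈ Metric.sphere (0 : Fin 2 → ℝ) 1 := by
  rw [mem_sphere_zero_iff_norm, squareLoop, norm_smul, norm_inv, norm_norm]
  exact inv_mul_cancel₀ (norm_ne_zero_iff.2 (cos_sin_ne_zero t))

theorem squareLoop_zero_eq_one : squareLoop 0 = squareLoop 1 := by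
  simp [squareLoop]

theorem squareLoop_image : squareLoop '' Icc 0 1 = Metric.sphere (0 : Fin 2 → ℝ) 1 := by
  refine subset_antisymm (image_subset_iff.2 fun t _ => squareLoop_mem_sphere t) fun x hx => ?_
  rw [mem_sphere_zero_iff_norm] at hx
  set z : ℂ := ⟨x 0, x 1⟩ with hz
  have hz0 : z ≠ 0 := by
    intro h
    have h0 : x 0 = 0 := congrArg Complex.re h
    have h1 : x 1 = 0 := congrArg Complex.im h
    have : x = 0 := by
      funext i
      fin_cases i
      · exact h0
      · exact h1
    rw [this, norm_zero] at hx
    norm_num at hx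
  have hpos : 0 < ‖z‖ := norm_pos_iff.2 hz0
  -- the loop passes through `x` at each parameter whose angle is the argument of `z`
  have key : ∀ t : ℝ, Real.cos (2 * Real.pi * t) = Real.cos z.arg →
      Real.sin (2 * Real.pi * t) = Real.sin z.arg → squareLoop t = x := by
    intro t hc hs
    have e : ![Real.cos (2 * Real.pi * t), Real.sin (2 * Real.pi * t)] = ‖z‖⁻¹ • x := by
      rw [hc, hs, Complex.cos_arg hz0, Complex.sin_arg]
      funext i
      fin_cases i
      · simp [hz, div_eq_inv_mul]
      · simp [hz, div_eq_inv_mul]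
    rw [squareLoop, e, norm_smul, hx, mul_one, norm_inv, norm_norm, inv_inv, smul_smul,
      mul_inv_cancel₀ hpos.ne', one_smul]
  have hpi := Real.pi_pos
  rcases le_or_gt 0 z.arg with h | h
  · refine ⟨z.arg / (2 * Real.pi), ⟨by positivity, ?_⟩, ?_⟩
    · rw [div_le_one (by positivity)]
      linarith [Complex.arg_le_pi z]
    · have e : 2 * Real.pi * (z.arg / (2 * Real.pi)) = z.arg := by field_simp
      exact key _ (by rw [e]) (by rw [e])
  · refine ⟨z.arg / (2 * Real.pi) + 1, ⟨?_, ?_⟩, ?_⟩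
    · rw [← sub_neg_eq_add, sub_nonneg, le_div_iff₀ (by positivity)]
      linarith [Complex.neg_pi_lt_arg z]
    · have : z.arg / (2 * Real.pi) < 0 := div_neg_of_neg_of_pos h (by positivity)
      linarith
    · have e : 2 * Real.pi * (z.arg / (2 * Real.pi) + 1) = z.arg + 2 * Real.pi := by field_simp
      exact key _ (by rw [e, Real.cos_add_two_pi]) (by rw [e, Real.sin_add_two_pi])

theorem squareLoop_eq_iff {s t : ℝ} (h : squareLoop s = squareLoop t) : ∃ n : ℤ, s = t + n := by
  set a := ‖![Real.cos (2 * Real.pi * s), Real.sin (2 * Real.pi * s)]‖⁻¹ with ha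
  set b := ‖![Real.cos (2 * Real.pi * t), Real.sin (2 * Real.pi * t)]‖⁻¹ with hb
  have ha0 : 0 < a := inv_pos.2 (norm_pos_iff.2 (cos_sin_ne_zero s))
  have hb0 : 0 < b := inv_pos.2 (norm_pos_iff.2 (cos_sin_ne_zero t))
  have h0 : a * Real.cos (2 * Real.pi * s) = b * Real.cos (2 * Real.pi * t) := by
    simpa [squareLoop, ← ha, ← hb] using congrFun h 0
  have h1 : a * Real.sin (2 * Real.pi * s) = b * Real.sin (2 * Real.pi * t) := by
    simpa [squareLoop, ← ha, ← hb] using congrFun h 1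
  have hab : a = b := by
    have e1 := Real.sin_sq_add_cos_sq (2 * Real.pi * s)
    have e2 := Real.sin_sq_add_cos_sq (2 * Real.pi * t)
    have : a ^ 2 = b ^ 2 := by
      calc a ^ 2 = (a * Real.sin (2 * Real.pi * s)) ^ 2 + (a * Real.cos (2 * Real.pi * s)) ^ 2 := by
            linear_combination (-a ^ 2) * e1
        _ = (b * Real.sin (2 * Real.pi * t)) ^ 2 + (b * Real.cos (2 * Real.pi * t)) ^ 2 := by
            rw [h0, h1]
        _ = b ^ 2 := by linear_combination (b ^ 2) * e2
    exact (pow_left_inj₀ ha0.le hb0.le two_ne_zero).1 this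
  rw [hab] at h0 h1
  have hc := mul_left_cancel₀ hb0.ne' h0
  have hs := mul_left_cancel₀ hb0.ne' h1
  obtain ⟨n, hn⟩ := (Real.Angle.angle_eq_iff_two_pi_dvd_sub).1
    (Real.Angle.cos_sin_inj hc hs)
  refine ⟨n, ?_⟩
  have hpi := Real.pi_pos
  have : 2 * Real.pi * (s - t - n) = 0 := by linear_combination hn
  rcases mul_eq_zero.1 this with h | h
  · linarith
  · linarith

/-- A cocycle on the boundary of the square with trivial holonomy has a primitive. -/
theorem IsLocCocycle.exists_isLocPrimitive_square {φ : (Fin 2 → ℝ) → (Fin 2 → ℝ) → ZMod 2}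
    (h : IsLocCocycle (Metric.sphere 0 1) φ) {F : ℝ → ZMod 2}
    (hF : IsLocPrimitive (Icc 0 1) (fun s t => φ (squareLoop s) (squareLoop t)) F)
    (h01 : F 0 = F 1) : ∃ f, IsLocPrimitive (Metric.sphere 0 1) φ f := by
  classical
  have hFF : ∀ s ∈ Icc (0 : ℝ) 1, ∀ t ∈ Icc (0 : ℝ) 1, squareLoop s = squareLoop t →
      F s = F t := by
    intro s hs t ht hst
    obtain ⟨n, hn⟩ := squareLoop_eq_iff hst
    have h1 : (n : ℝ) < 2 := by linarith [hs.2, ht.1]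
    have h2 : (-2 : ℝ) < n := by linarith [hs.1, ht.2]
    have h1' : n < 2 := by exact_mod_cast h1
    have h2' : -2 < n := by exact_mod_cast h2
    rcases (by omega : n = -1 ∨ n = 0 ∨ n = 1) with rfl | rfl | rfl
    · push_cast at hn
      have e1 : s = 0 := by linarith [hs.1, ht.2]
      have e2 : t = 1 := by linarith [hs.1, ht.2]
      rw [e1, e2, h01]
    · push_cast at hn
      rw [hn, add_zero]
    · push_cast at hn
      have e1 : s = 1 := by linarith [hs.2, ht.1]
      have e2 : t = 0 := by linarith [hs.2, ht.1]
      rw [e1, e2, h01]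
  set f : (Fin 2 → ℝ) → ZMod 2 := fun x =>
    if hx : ∃ t ∈ Icc (0 : ℝ) 1, squareLoop t = x then F hx.choose else 0 with hf
  have hfF : ∀ t ∈ Icc (0 : ℝ) 1, f (squareLoop t) = F t := by
    intro t ht
    have hx : ∃ t' ∈ Icc (0 : ℝ) 1, squareLoop t' = squareLoop t := ⟨t, ht, rfl⟩
    have e : f (squareLoop t) = F hx.choose := dif_pos hx
    rw [e]
    exact hFF _ hx.choose_spec.1 _ ht hx.choose_spec.2
  refine ⟨f, ?_⟩
  rw [← squareLoop_image] at h ⊢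
  exact h.isLocPrimitive_image isCompact_Icc continuous_squareLoop.continuousOn
    (hF.congr (fun _ _ _ _ => rfl) hfF)

end Cochains

open Set Topology Topology.CWComplex

/-! ### Skeleta of finite CW complexes -/

theorem mem_sphere_or_mem_ball {n : ℕ} {t : Fin n → ℝ} (ht : t ∈ Metric.closedBall 0 1) :
    t ∈ Metric.sphere (0 : Fin n → ℝ) 1 ∨ t ∈ Metric.ball (0 : Fin n → ℝ) 1 := by
  rwa [← Metric.sphere_union_ball] at ht

section Skeleton

variable {X : Type*} [TopologicalSpace X] [T2Space X] (C : Set X) [CWComplex C]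

/-- The union of the closed cells of dimension less than `n`, as a set. -/
def skel (n : ℕ) : Set X := skeletonLT C (n : ℕ∞)

theorem skel_zero : skel C 0 = ∅ := by
  simpa [skel] using CWComplex.skeletonLT_zero_eq_empty (C := C)

theorem skel_succ (n : ℕ) : skel C (n + 1) = skel C n ∪ ⋃ e : cell C n, closedCell n e := by
  have := CWComplex.skeletonLT_union_iUnion_closedCell_eq_skeletonLT_succ (C := C) n
  rw [skel, skel, this]
  push_cast
  rfl

theorem skel_mono {m n : ℕ} (h : m ≤ n) : skel C m ⊆ skel C n :=
  CWComplex.skeletonLT_mono (by exact_mod_cast h)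

theorem skel_subset (n : ℕ) : skel C n ⊆ C := RelCWComplex.Subcomplex.subset_complex _

theorem map_mem_skel_succ {n : ℕ} (e : cell C n) {t : Fin n → ℝ}
    (ht : t ∈ Metric.closedBall 0 1) : map n e t ∈ skel C (n + 1) := by
  rw [skel_succ]
  exact Or.inr (mem_iUnion.2 ⟨e, t, ht, rfl⟩)

theorem map_mem_skel {n : ℕ} (e : cell C n) {t : Fin n → ℝ}
    (ht : t ∈ Metric.sphere 0 1) : map n e t ∈ skel C n :=
  CWComplex.cellFrontier_subset_skeletonLT n e ⟨t, ht, rfl⟩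

theorem notMem_openCell_of_mem_skel {m n : ℕ} (h : m ≤ n) {x : X} (hx : x ∈ skel C m)
    (e : cell C n) : x ∉ openCell n e := fun hxe =>
  (CWComplex.disjoint_skeletonLT_openCell (by exact_mod_cast h)).le_bot ⟨hx, hxe⟩

theorem exists_skel_eq [CWComplex.Finite C] : ∃ N, ∀ n, N ≤ n → skel C n = C := by
  obtain ⟨N, hN⟩ := Filter.eventually_atTop.1
    (RelCWComplex.FiniteDimensional.eventually_isEmpty_cell (C := C) (D := ∅))
  have hsub : ∀ m, skel C m ⊆ skel C N := by
    intro m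
    induction m with
    | zero => rw [skel_zero]; exact empty_subset _
    | succ m ih =>
      rcases lt_or_ge m N with hm | hm
      · exact skel_mono C hm
      · rw [skel_succ]
        refine union_subset ih (iUnion_subset fun e => ?_)
        exact ((hN m hm).false e).elim
  refine ⟨N, fun n hn => subset_antisymm (skel_subset C n) ?_⟩
  have := CWComplex.iUnion_skeletonLT_eq_complex (C := C)
  intro x hx
  rw [← this] at hx
  obtain ⟨m, hm⟩ := mem_iUnion.1 hx
  exact skel_mono C hn (hsub m hm)

theorem eq_of_map_eq {n : ℕ} {e e' : cell C n} {u t : Fin n → ℝ} (hu : u ∈ Metric.ball 0 1)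
    (ht : t ∈ Metric.closedBall 0 1) (h : map n e' t = map n e u) : e' = e ∧ t = u := by
  have ht' : t ∈ Metric.ball 0 1 := by
    rcases mem_sphere_or_mem_ball ht with hs | hb
    · exact (notMem_openCell_of_mem_skel C le_rfl (map_mem_skel C e' hs) e
        (h ▸ ⟨u, hu, rfl⟩)).elim
    · exact hb
  have he : (⟨n, e'⟩ : Σ n, cell C n) = ⟨n, e⟩ := by
    refine CWComplex.eq_of_not_disjoint_openCell (not_disjoint_iff.2 ⟨map n e' t, ⟨t, ht', rfl⟩, ?_⟩)
    rw [h]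
    exact ⟨u, hu, rfl⟩
  obtain rfl : e' = e := by simpa using he
  refine ⟨rfl, (map n e').injOn ?_ ?_ h⟩
  · rw [source_eq]; exact ht'
  · rw [source_eq]; exact hu

variable {C}

/-- Neighbourhoods in a skeleton can be recognised in the previous skeleton and in the closed
cells. -/
theorem mem_nhdsWithin_skel_succ [CWComplex.Finite C] {n : ℕ} {z : X} {V : Set X}
    (h0 : z ∈ skel C n → V ∈ 𝓝[skel C n] z)
    (h : ∀ e : cell C n, ∀ t ∈ Metric.closedBall (0 : Fin n → ℝ) 1, map n e t = z →
      map n e ⁻¹' V ∈ 𝓝[Metric.closedBall 0 1] t) : V ∈ 𝓝[skel C (n + 1)] z := by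
  have : _root_.Finite (cell C n) := FiniteType.finite_cell n
  rw [skel_succ, nhdsWithin_union, nhdsWithin_iUnion, Filter.mem_sup, Filter.mem_iSup]
  refine ⟨?_, fun e => mem_nhdsWithin_image (isCompact_closedBall _ _) (continuousOn n e) (h e)⟩
  by_cases hz : z ∈ skel C n
  · exact h0 hz
  · have hcl : IsClosed (skel C n) := (skeletonLT C (n : ℕ∞)).closed
    have : 𝓝[skel C n] z = ⊥ := by
      rwa [← notMem_closure_iff_nhdsWithin_eq_bot, hcl.closure_eq]
    simp [this]

/-- An Alexander–Spanier one-cocycle on a skeleton extends over the cells of the next dimension if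
its pullbacks to the boundary spheres of these cells have primitives. -/
theorem IsLocCocycle.exists_extension [CWComplex.Finite C] {n : ℕ} {φ : X → X → ZMod 2}
    (hφ : IsLocCocycle (skel C n) φ)
    (h : ∀ e : cell C n, ∃ f, IsLocPrimitive (Metric.sphere 0 1)
      (fun s t => φ (map n e s) (map n e t)) f) :
    ∃ φ', IsLocCocycle (skel C (n + 1)) φ' ∧
      ∀ x ∈ skel C n, ∀ y ∈ skel C n, φ' x y = φ x y := by
  classical
  choose f hf using h
  -- `ρ` is the radial projection of the open cells to their boundaries, and `k` collects the
  -- primitives on the boundary spheres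
  set r : (Fin n → ℝ) → Fin n → ℝ := fun u => ‖u‖⁻¹ • u with hr
  have hrs : ∀ u, u ≠ 0 → r u ∈ Metric.sphere (0 : Fin n → ℝ) 1 := fun u hu => by
    rw [mem_sphere_zero_iff_norm, norm_smul, norm_inv, norm_norm]
    exact inv_mul_cancel₀ (norm_ne_zero_iff.2 hu)
  have hrc : ∀ u, u ≠ 0 → ContinuousAt r u := fun u hu =>
    (continuousAt_id.norm.inv₀ (norm_ne_zero_iff.2 hu)).smul continuousAt_id
  set ρ : X → X := fun x => if hx : ∃ e, x ∈ openCell (C := C) n e then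
    map n hx.choose (r ((map n hx.choose).symm x)) else x with hρ
  set k : X → ZMod 2 := fun x => if hx : ∃ e, x ∈ openCell (C := C) n e then
    f hx.choose (r ((map n hx.choose).symm x)) else 0 with hk
  have hball : ∀ (e : cell C n) (u : Fin n → ℝ), u ∈ Metric.ball 0 1 →
      ρ (map n e u) = map n e (r u) ∧ k (map n e u) = f e (r u) := by
    intro e u hu
    have hx : ∃ e', map n e u ∈ openCell (C := C) n e' := ⟨e, u, hu, rfl⟩
    have he : hx.choose = e := by
      obtain ⟨t, ht, htu⟩ := hx.choose_spec
      exact (eq_of_map_eq C hu (Metric.ball_subset_closedBall ht) htu).1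
    have hs : (map n e).symm (map n e u) = u := (map n e).left_inv (by rwa [source_eq])
    have e1 : ρ (map n e u) = map n hx.choose (r ((map n hx.choose).symm (map n e u))) :=
      dif_pos hx
    have e2 : k (map n e u) = f hx.choose (r ((map n hx.choose).symm (map n e u))) :=
      dif_pos hx
    rw [e1, e2, he, hs]
    exact ⟨rfl, rfl⟩
  have hskel : ∀ x ∈ skel C n, ρ x = x ∧ k x = 0 := by
    intro x hx
    have hx' : ¬ ∃ e, x ∈ openCell (C := C) n e := by
      rintro ⟨e, he⟩
      exact notMem_openCell_of_mem_skel C le_rfl hx e he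
    exact ⟨dif_neg hx', dif_neg hx'⟩
  have hclosed : ∀ (e : cell C n) (t : Fin n → ℝ), t ∈ Metric.closedBall 0 1 →
      ρ (map n e t) = map n e (r t) := by
    intro e t ht
    rcases mem_sphere_or_mem_ball ht with hs | hb
    · rw [(hskel _ (map_mem_skel C e hs)).1]
      simp [hr, mem_sphere_zero_iff_norm.1 hs]
    · exact (hball e t hb).1
  -- the cores of the cells, where the radial projection is not continuous
  set core : Set X := {x | ∃ e : cell C n, ∃ u ∈ Metric.ball (0 : Fin n → ℝ) 1,
    ‖u‖ < 1 / 2 ∧ map n e u = x} with hcore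
  set P : X → X → Prop := fun x y => ∃ e : cell C n, x ∈ openCell n e ∧ y ∈ openCell n e ∧
    (x ∈ core ∨ y ∈ core) with hP
  set φ' : X → X → ZMod 2 := fun x y => if P x y then 0 else φ (ρ x) (ρ y) + k x + k y with hφ'
  have hφ'skel : ∀ x ∈ skel C n, ∀ y ∈ skel C n, φ' x y = φ x y := by
    intro x hx y hy
    have hnP : ¬ P x y := by
      rintro ⟨e, he, -⟩
      exact notMem_openCell_of_mem_skel C le_rfl hx e he
    rw [hφ']
    simp only [if_neg hnP]
    rw [(hskel x hx).1, (hskel y hy).1, (hskel x hx).2, (hskel y hy).2, add_zero, add_zero]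
  refine ⟨φ', fun z hz => ?_, hφ'skel⟩
  by_cases hzn : z ∈ skel C n
  · obtain ⟨U, hU, hUc⟩ := hφ z hzn
    refine ⟨{x | ρ x ∈ U ∧ x ∉ core}, mem_nhdsWithin_skel_succ (fun _ => ?_) ?_, ?_⟩
    · filter_upwards [hU, self_mem_nhdsWithin] with x hx hxs
      refine ⟨by rwa [(hskel x hxs).1], ?_⟩
      rintro ⟨e, u, hu, -, hux⟩
      exact notMem_openCell_of_mem_skel C le_rfl hxs e ⟨u, hu, hux⟩
    · rintro e t ht rfl
      have hts : t ∈ Metric.sphere (0 : Fin n → ℝ) 1 := by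
        rcases mem_sphere_or_mem_ball ht with hs | hb
        · exact hs
        · exact (notMem_openCell_of_mem_skel C le_rfl hzn e ⟨t, hb, rfl⟩).elim
      have ht1 := mem_sphere_zero_iff_norm.1 hts
      have ht0 : t ≠ 0 := by
        rintro rfl
        simp at ht1
      have hrt : r t = t := by simp [hr, ht1]
      have hnear : ∀ᶠ t' in 𝓝[Metric.closedBall 0 1] t, 1 / 2 < ‖t'‖ :=
        nhdsWithin_le_nhds (continuous_norm.continuousAt.eventually
          (lt_mem_nhds (show 1 / 2 < ‖t‖ by rw [ht1]; norm_num)))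
      have hne : ∀ t' : Fin n → ℝ, 1 / 2 < ‖t'‖ → t' ≠ 0 := by
        rintro _ h rfl
        norm_num at h
      have h1 : Filter.Tendsto r (𝓝[Metric.closedBall 0 1] t) (𝓝[Metric.sphere 0 1] (r t)) :=
        tendsto_nhdsWithin_iff.2 ⟨(hrc t ht0).tendsto.mono_left nhdsWithin_le_nhds, by
          filter_upwards [hnear] with t' ht' using hrs t' (hne t' ht')⟩
      have h2 : Filter.Tendsto (map n e) (𝓝[Metric.sphere 0 1] (r t))
          (𝓝[skel C n] (map n e t)) := by
        rw [hrt]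
        exact (((continuousOn n e).mono Metric.sphere_subset_closedBall) t
          hts).tendsto_nhdsWithin fun s hs => map_mem_skel C e hs
      filter_upwards [hnear, h2.comp h1 hU, self_mem_nhdsWithin] with t' ht' htU htb
      refine ⟨?_, ?_⟩
      · rw [hclosed e t' htb]
        exact htU
      · rintro ⟨e', u, hu, hu2, hux⟩
        have := (eq_of_map_eq C hu htb hux.symm).2
        rw [this] at ht'
        linarith
    · have hform : ∀ x, (ρ x ∈ U ∧ x ∉ core) → ∀ y, (ρ y ∈ U ∧ y ∉ core) →
          φ' x y = φ (ρ x) (ρ y) + k x + k y := by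
        intro x hx y hy
        refine if_neg ?_
        rintro ⟨e, -, -, hc | hc⟩
        · exact hx.2 hc
        · exact hy.2 hc
      intro x hx y hy w hw
      rw [hform x hx y hy, hform y hy w hw, hform x hx w hw, ← hUc _ hx.1 _ hy.1 _ hw.1]
      have : ∀ a b c d e : ZMod 2, a + b + c + (d + c + e) = a + d + b + e := by decide
      exact this _ _ _ _ _
  · obtain ⟨e, u₀, hu₀, hzu⟩ : ∃ e : cell C n, ∃ u₀ ∈ Metric.ball (0 : Fin n → ℝ) 1,
        map n e u₀ = z := by
      rw [skel_succ] at hz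
      obtain ⟨e, t, ht, htz⟩ := mem_iUnion.1 (hz.resolve_left hzn)
      rcases mem_sphere_or_mem_ball ht with hs | hb
      · exact (hzn (htz ▸ map_mem_skel C e hs)).elim
      · exact ⟨e, t, hb, htz⟩
    -- inside an open cell the extension vanishes near the diagonal
    obtain ⟨N, hN, hNb, hN0⟩ : ∃ N ∈ 𝓝 u₀, N ⊆ Metric.ball (0 : Fin n → ℝ) 1 ∧
        ∀ u ∈ N, ∀ w ∈ N, φ' (map n e u) (map n e w) = 0 := by
      have hb := Metric.isOpen_ball.mem_nhds hu₀
      rcases lt_or_ge ‖u₀‖ (1 / 2) with hlt | hge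
      · refine ⟨{u | ‖u‖ < 1 / 2} ∩ Metric.ball 0 1, Filter.inter_mem
          (continuous_norm.continuousAt.eventually (gt_mem_nhds hlt)) hb, inter_subset_right, ?_⟩
        intro u hu w hw
        exact if_pos ⟨e, ⟨u, hu.2, rfl⟩, ⟨w, hw.2, rfl⟩, Or.inl ⟨e, u, hu.2, hu.1, rfl⟩⟩
      · have hu0 : u₀ ≠ 0 := by
          rintro rfl
          norm_num at hge
        obtain ⟨W, hW, hWf⟩ := hf e (r u₀) (hrs u₀ hu0)
        have ht : Filter.Tendsto r (𝓝 u₀) (𝓝[Metric.sphere 0 1] (r u₀)) :=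
          tendsto_nhdsWithin_iff.2 ⟨hrc u₀ hu0, by
            filter_upwards [isOpen_ne.mem_nhds hu0] with u hu using hrs u hu⟩
        refine ⟨r ⁻¹' W ∩ Metric.ball 0 1, Filter.inter_mem (ht hW) hb, inter_subset_right, ?_⟩
        intro u hu w hw
        by_cases hc : P (map n e u) (map n e w)
        · exact if_pos hc
        · have e1 : φ' (map n e u) (map n e w) = φ (ρ (map n e u)) (ρ (map n e w)) +
            k (map n e u) + k (map n e w) := if_neg hc
          have hWuw : φ (map n e (r u)) (map n e (r w)) = f e (r u) + f e (r w) :=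
            hWf _ hu.1 _ hw.1
          rw [e1, (hball e u hu.2).1, (hball e w hw.2).1, (hball e u hu.2).2,
            (hball e w hw.2).2, hWuw]
          have : ∀ a b : ZMod 2, a + b + a + b = 0 := by decide
          exact this _ _
    refine ⟨map n e '' N, mem_nhdsWithin_skel_succ (fun hc => (hzn hc).elim) ?_, ?_⟩
    · intro e' t ht htz
      obtain ⟨rfl, rfl⟩ := eq_of_map_eq C hu₀ ht (htz.trans hzu.symm)
      exact Filter.mem_of_superset (mem_nhdsWithin_of_mem_nhds hN) (subset_preimage_image _ _)
    · rintro _ ⟨x, hx, rfl⟩ _ ⟨y, hy, rfl⟩ _ ⟨w, hw, rfl⟩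
      rw [hN0 x hx y hy, hN0 y hy w hw, hN0 x hx w hw, add_zero]

end Skeleton

/-! ### Cellular and Alexander–Spanier cochains in degree one -/

section Edges

variable {X : Type*} [TopologicalSpace X] [T2Space X] {C : Set X} [CWComplex C]

omit [T2Space X] in
theorem mem_closedCell_zero_iff {v : cell C 0} {x : X} :
    x ∈ closedCell 0 v ↔ x = map 0 v ![] := by
  rw [CWComplex.closedCell_zero_eq_singleton, mem_singleton_iff]

theorem exists_eq_map_zero {x : X} (hx : x ∈ skel C 1) : ∃ v : cell C 0, x = map 0 v ![] := by
  rw [skel_succ, skel_zero, empty_union] at hx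
  obtain ⟨v, hv⟩ := mem_iUnion.1 hx
  exact ⟨v, mem_closedCell_zero_iff.1 hv⟩

theorem const_mem_sphere {σ : ℝ} (hσ : |σ| = 1) :
    (fun _ => σ) ∈ Metric.sphere (0 : Fin 1 → ℝ) 1 := by
  rw [mem_sphere_zero_iff_norm, pi_norm_const, Real.norm_eq_abs, hσ]

theorem exists_tail (e : cell C 1) : ∃ v : cell C 0, map 1 e (fun _ => -1) = map 0 v ![] :=
  exists_eq_map_zero (map_mem_skel C e (const_mem_sphere (by simp)))

theorem exists_head (e : cell C 1) : ∃ v : cell C 0, map 1 e (fun _ => 1) = map 0 v ![] :=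
  exists_eq_map_zero (map_mem_skel C e (const_mem_sphere (by simp)))

/-- The vertex at which the edge `e` starts. -/
def tail (e : cell C 1) : cell C 0 := (exists_tail e).choose

/-- The vertex at which the edge `e` ends. -/
def head (e : cell C 1) : cell C 0 := (exists_head e).choose

theorem map_tail (e : cell C 1) : map 0 (tail e) ![] = map 1 e (fun _ => -1) :=
  (exists_tail e).choose_spec.symm

theorem map_head (e : cell C 1) : map 0 (head e) ![] = map 1 e (fun _ => 1) :=
  (exists_head e).choose_spec.symm

open scoped Classical in
theorem endCount_eq (e : cell C 1) (v : cell C 0) :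
    endCount C e v = (if tail e = v then 1 else 0) + if head e = v then 1 else 0 := by
  have h1 : map 1 e (fun _ => -1) ∈ closedCell 0 v ↔ tail e = v := by
    rw [mem_closedCell_zero_iff, ← map_tail]
    exact (CWComplex.injective_map_zero C).eq_iff
  have h2 : map 1 e (fun _ => 1) ∈ closedCell 0 v ↔ head e = v := by
    rw [mem_closedCell_zero_iff, ← map_head]
    exact (CWComplex.injective_map_zero C).eq_iff
  simp only [endCount, h1, h2]

theorem sum_endCount_mul [Fintype (cell C 0)] (e : cell C 1) (s : cell C 0 → ZMod 2) :
    ∑ v, (endCount C e v : ZMod 2) * s v = s (tail e) + s (head e) := by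
  classical
  simp [endCount_eq, add_mul, Finset.sum_add_distrib]

omit [T2Space X] in
theorem collapse_of_notMem {e : cell C 1} {x : X} (hx : x ∉ openCell 1 e) :
    collapse C e x = 0 := if_neg hx

theorem collapse_of_mem_skel_one (e : cell C 1) {x : X} (hx : x ∈ skel C 1) :
    collapse C e x = 0 := collapse_of_notMem (notMem_openCell_of_mem_skel C le_rfl hx e)

theorem eq_const_of_mem_sphere {t : Fin 1 → ℝ} (ht : t ∈ Metric.sphere 0 1) :
    t = (fun _ => -1) ∨ t = fun _ => 1 := by
  rw [mem_sphere_zero_iff_norm] at ht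
  have ht' : t = fun _ => t 0 := by
    funext i
    rw [Subsingleton.elim i 0]
  rw [ht', pi_norm_const, Real.norm_eq_abs] at ht
  rw [ht']
  rcases eq_or_eq_neg_of_abs_eq ht with h | h
  · right; rw [h]
  · left; rw [h]

theorem abs_lt_one_of_mem_ball {t : Fin 1 → ℝ} (ht : t ∈ Metric.ball 0 1) : |t 0| < 1 :=
  (norm_le_pi_norm t 0).trans_lt (mem_ball_zero_iff.1 ht)

theorem collapse_map (e : cell C 1) {t : Fin 1 → ℝ} (ht : t ∈ Metric.closedBall 0 1) :
    collapse C e (map 1 e t) = (((t 0 + 1) / 2 : ℝ) : AddCircle (1 : ℝ)) := by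
  rcases mem_sphere_or_mem_ball ht with hs | hb
  · rw [collapse_of_mem_skel_one e (map_mem_skel C e hs)]
    rcases eq_const_of_mem_sphere hs with rfl | rfl
    · norm_num
    · norm_num
      exact (AddCircle.coe_period 1).symm
  · have : (map 1 e).symm (map 1 e t) = t := (map 1 e).left_inv (by rwa [source_eq])
    rw [collapse, if_pos ⟨t, hb, rfl⟩, this]

theorem collapse_map_of_ne {e e' : cell C 1} (h : e' ≠ e) {t : Fin 1 → ℝ}
    (ht : t ∈ Metric.closedBall 0 1) : collapse C e (map 1 e' t) = 0 := by
  refine collapse_of_notMem ?_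
  rintro ⟨u, hu, hut⟩
  exact h (eq_of_map_eq C hu ht hut.symm).1

variable [CWComplex.Finite C]

theorem continuousOn_collapse (e : cell C 1) : ContinuousOn (collapse C e) (skel C 2) := by
  intro z hz N hN
  refine mem_nhdsWithin_skel_succ (fun hz1 => ?_) ?_
  · rw [collapse_of_mem_skel_one e hz1] at hN
    filter_upwards [self_mem_nhdsWithin] with x hx
    rw [mem_preimage, collapse_of_mem_skel_one e hx]
    exact mem_of_mem_nhds hN
  · rintro e' t ht rfl
    by_cases he : e' = e
    · subst he
      rw [collapse_map _ ht] at hN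
      have hc : Continuous fun t : Fin 1 → ℝ => (((t 0 + 1) / 2 : ℝ) : AddCircle (1 : ℝ)) :=
        (AddCircle.continuous_mk' 1).comp (by fun_prop)
      filter_upwards [nhdsWithin_le_nhds (hc.continuousAt.eventually hN), self_mem_nhdsWithin]
        with s hs hsb
      rw [mem_preimage, mem_preimage, collapse_map _ hsb]
      exact hs
    · rw [collapse_map_of_ne he ht] at hN
      filter_upwards [self_mem_nhdsWithin] with s hs
      rw [mem_preimage, mem_preimage, collapse_map_of_ne he hs]
      exact mem_of_mem_nhds hN

attribute [local instance] fintypeCell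

variable (c : cell C 1 → ZMod 2)

/-- The Alexander–Spanier one-cocycle on the one-skeleton determined by a cellular one-cochain `c`:
the double cover which is twisted along the edges `e` with `c e = 1`. -/
def edgeCocycle (x y : X) : ZMod 2 :=
  ∑ e, c e * circleCocycle (collapse C e x) (collapse C e y)

theorem isLocCocycle_edgeCocycle : IsLocCocycle (skel C 2) (edgeCocycle c) :=
  IsLocCocycle.sum _ c fun e _ =>
    isLocCocycle_circleCocycle.comap (continuousOn_collapse e) (mapsTo_univ _ _)

theorem isLocPrimitive_edgeCocycle_map (e : cell C 1) :
    IsLocPrimitive (Metric.closedBall 0 1)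
      (fun s t => edgeCocycle c (map 1 e s) (map 1 e t))
      fun t => c e * ((⌊(t 0 + 1) / 2⌋ : ℤ) : ZMod 2) := by
  classical
  have h := IsLocPrimitive.sum (Finset.univ : Finset (cell C 1))
    (S := Metric.closedBall (0 : Fin 1 → ℝ) 1)
    (φ := fun e' s t => circleCocycle (collapse C e' (map 1 e s)) (collapse C e' (map 1 e t)))
    (f := fun e' t => ((⌊if e' = e then (t 0 + 1) / 2 else 0⌋ : ℤ) : ZMod 2)) c fun e' _ => by
      refine isLocPrimitive_circleCocycle (κ := fun t => collapse C e' (map 1 e t))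
        (g := fun t => if e' = e then (t 0 + 1) / 2 else 0) ?_ ?_
      · split_ifs
        · fun_prop
        · fun_prop
      · intro t ht
        split_ifs with he
        · subst he
          exact collapse_map _ ht
        · rw [collapse_map_of_ne (Ne.symm he) ht]
          rfl
  refine h.congr (fun _ _ _ _ => rfl) fun t _ => ?_
  rw [Finset.sum_eq_single e]
  · simp
  · intro e' _ he
    simp [he]
  · simp

omit [CWComplex.Finite C] in
theorem map_squareLoop_mem_skel (p : cell C 2) (t : ℝ) : map 2 p (squareLoop t) ∈ skel C 2 :=
  map_mem_skel C p (squareLoop_mem_sphere t)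

omit [T2Space X] [CWComplex.Finite C] in
theorem continuous_map_squareLoop (p : cell C 2) :
    Continuous fun t => map 2 p (squareLoop t) :=
  ((continuousOn 2 p).mono Metric.sphere_subset_closedBall).comp_continuous
    continuous_squareLoop squareLoop_mem_sphere

/-- The holonomy of the double cover determined by `c` along the boundary of a two-cell is the
value of the cellular coboundary of `c` there. -/
theorem exists_isLocPrimitive_attaching (p : cell C 2) :
    ∃ F, IsLocPrimitive (Icc 0 1) (fun s t =>
      edgeCocycle c (map 2 p (squareLoop s)) (map 2 p (squareLoop t))) F ∧
      F 0 + F 1 = ∑ e, c e * (windingCount C p e : ZMod 2) := by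
  have hw : ∀ e, HasWindingNumber (attachingLoop C p e) (windingCount C p e) := by
    intro e
    have hex : ∃ n, HasWindingNumber (attachingLoop C p e) n := by
      refine exists_hasWindingNumber (Continuous.continuousOn ?_) ?_
      · exact (continuousOn_collapse e).comp_continuous (continuous_map_squareLoop p)
          (map_squareLoop_mem_skel p)
      · simp only [attachingLoop, squareLoop_zero_eq_one]
    rw [windingCount, dif_pos hex]
    exact hex.choose_spec
  choose g hgc hg hg01 using hw
  refine ⟨fun t => ∑ e, c e * ((⌊g e t⌋ : ℤ) : ZMod 2), IsLocPrimitive.sum _ c fun e _ =>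
    isLocPrimitive_circleCocycle (hgc e) fun t ht => (hg e t ht).symm, ?_⟩
  rw [← Finset.sum_add_distrib]
  refine Finset.sum_congr rfl fun e _ => ?_
  have h1 : g e 1 = g e 0 + (windingCount C p e : ℤ) := by linarith [hg01 e]
  have hz : ∀ a b d : ZMod 2, d * a + d * (a + b) = d * b := by decide
  rw [h1, Int.floor_add_intCast]
  push_cast
  exact hz _ _ _

/-- A primitive of the Alexander–Spanier cocycle determined by `c` restricts to a cellular
primitive of `c` on the vertices. -/
theorem eq_add_of_isLocPrimitive {f : X → ZMod 2}
    (hf : IsLocPrimitive (skel C 2) (edgeCocycle c) f) (e : cell C 1) :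
    c e = f (map 0 (tail e) ![]) + f (map 0 (head e) ![]) := by
  have h1 := hf.comap (continuousOn 1 e) (T := Metric.closedBall 0 1)
    fun t ht => map_mem_skel_succ C e ht
  have h2 := isLocPrimitive_edgeCocycle_map c e
  have hm : ∀ σ : ℝ, |σ| = 1 → (fun _ => σ) ∈ Metric.closedBall (0 : Fin 1 → ℝ) 1 := fun σ hσ =>
    Metric.sphere_subset_closedBall (const_mem_sphere hσ)
  have := h1.add_eq_add (convex_closedBall _ _).isPreconnected h2 (hm (-1) (by simp))
    (hm 1 (by simp))
  rw [map_tail, map_head]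
  norm_num at this
  rw [zmod_two_eq_add_iff, add_comm, this]
  have hz : ∀ a b : ZMod 2, a + b + b = a := by decide
  exact hz _ _

/-- If `c` is a cellular coboundary, then the Alexander–Spanier cocycle determined by `c` has a
primitive on the one-skeleton. -/
theorem exists_isLocPrimitive_of_coboundary (s : cell C 0 → ZMod 2)
    (hc : ∀ e, c e = s (tail e) + s (head e)) :
    ∃ f, IsLocPrimitive (skel C 2) (edgeCocycle c) f ∧ ∀ v, f (map 0 v ![]) = s v := by
  classical
  set f : X → ZMod 2 := fun x => if he : ∃ e, x ∈ openCell (C := C) 1 e then s (tail he.choose)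
    else if hv : ∃ v : cell C 0, map 0 v ![] = x then s hv.choose else 0 with hf
  have hv : ∀ v, f (map 0 v ![]) = s v := by
    intro v
    have h1 : ¬ ∃ e, map 0 v ![] ∈ openCell (C := C) 1 e := by
      rintro ⟨e, he⟩
      refine notMem_openCell_of_mem_skel C le_rfl (map_mem_skel_succ C v ?_) e he
      simp [Matrix.empty_eq]
    have h2 : ∃ v' : cell C 0, map 0 v' ![] = map 0 v ![] := ⟨v, rfl⟩
    have h3 : h2.choose = v := CWComplex.injective_map_zero C h2.choose_spec
    simp only [hf, dif_neg h1, dif_pos h2, h3]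
  have he : ∀ (e : cell C 1) (t : Fin 1 → ℝ), t ∈ Metric.closedBall 0 1 →
      f (map 1 e t) = c e * ((⌊(t 0 + 1) / 2⌋ : ℤ) : ZMod 2) + s (tail e) := by
    intro e t ht
    rcases mem_sphere_or_mem_ball ht with hs | hb
    · rcases eq_const_of_mem_sphere hs with rfl | rfl
      · rw [← map_tail, hv]
        norm_num
      · rw [← map_head, hv, hc]
        norm_num
        have hz : ∀ a b : ZMod 2, a = b + a + b := by decide
        exact hz _ _
    · have h1 : ∃ e', map 1 e t ∈ openCell (C := C) 1 e' := ⟨e, t, hb, rfl⟩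
      have h2 : h1.choose = e := by
        obtain ⟨u, hu, hut⟩ := h1.choose_spec
        exact (eq_of_map_eq C hu ht hut.symm).1.symm
      have h3 := abs_lt.1 (abs_lt_one_of_mem_ball hb)
      have h4 : ⌊(t 0 + 1) / 2⌋ = 0 := Int.floor_eq_zero_iff.2 ⟨by linarith, by linarith⟩
      simp only [hf, dif_pos h1, h2, h4, Int.cast_zero, mul_zero, zero_add]
  have hdiag : ∀ z ∈ skel C 2, edgeCocycle c z z = f z + f z := by
    intro z hz
    obtain ⟨U, hU, hUc⟩ := isLocCocycle_edgeCocycle c z hz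
    have hzU := mem_of_mem_nhdsWithin hz hU
    have := hUc z hzU z hzU z hzU
    rw [add_eq_left] at this
    rw [this, CharTwo.add_self_eq_zero]
  refine ⟨f, (isLocCocycle_edgeCocycle c).isLocPrimitive fun z hz => ?_, hv⟩
  refine mem_nhdsWithin_skel_succ (n := 1) (fun hz1 => ?_) ?_
  · refine mem_nhdsWithin_skel_succ (n := 0) (fun hz0 => ?_) ?_
    · rw [skel_zero] at hz0
      exact hz0.elim
    · rintro v t ht rfl
      refine Filter.Eventually.of_forall fun t' => ?_
      rw [Subsingleton.elim t' t]
      exact hdiag _ hz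
  · rintro e t ht rfl
    obtain ⟨U, hU, hUc⟩ := isLocPrimitive_edgeCocycle_map c e t ht
    filter_upwards [hU, self_mem_nhdsWithin] with t' ht' htb
    have := hUc t' ht' t (mem_of_mem_nhdsWithin ht hU)
    simp only [mem_preimage, mem_ofPred_eq]
    simp only at this
    rw [this, he e t' htb, he e t ht]
    have hz : ∀ a b d : ZMod 2, a + b = a + d + (b + d) := by decide
    exact hz _ _ _

/-- The square of the cellular coboundary vanishes. -/
theorem sum_mul_windingCount_eq_zero (s : cell C 0 → ZMod 2)
    (hc : ∀ e, c e = s (tail e) + s (head e)) (p : cell C 2) :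
    ∑ e, c e * (windingCount C p e : ZMod 2) = 0 := by
  obtain ⟨f, hf, -⟩ := exists_isLocPrimitive_of_coboundary c s hc
  obtain ⟨F, hF, hF01⟩ := exists_isLocPrimitive_attaching c p
  have h := hf.comap (continuous_map_squareLoop p).continuousOn (T := Icc 0 1)
    fun t _ => map_squareLoop_mem_skel p t
  have := h.add_eq_add isPreconnected_Icc hF (x := 0) (y := 1) (by simp) (by simp)
  rw [squareLoop_zero_eq_one] at this
  rw [← hF01, zmod_two_add_eq_zero_iff]
  exact add_left_cancel this

/-- A two-cell of a subcomplex has incidence number zero with edges outside of it. -/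
theorem windingCount_eq_zero (A : Subcomplex C) {p : cell C 2} (hp : p ∈ A.I 2) {e : cell C 1}
    (he : e ∉ A.I 1) : (windingCount C p e : ZMod 2) = 0 := by
  classical
  obtain ⟨F, hF, hF01⟩ := exists_isLocPrimitive_attaching (Pi.single e 1 : cell C 1 → ZMod 2) p
  have hcol : ∀ t, collapse C e (map 2 p (squareLoop t)) = 0 := by
    intro t
    refine collapse_of_notMem fun hc => ?_
    have h1 : map 2 p (squareLoop t) ∈ (A : Set X) := A.closedCell_subset_of_mem hp
      ⟨_, Metric.sphere_subset_closedBall (squareLoop_mem_sphere t), rfl⟩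
    exact (A.disjoint_openCell_subcomplex_of_not_mem he).le_bot ⟨hc, h1⟩
  have h00 : circleCocycle 0 0 = 0 := by simp [circleCocycle]
  have h0 : IsLocPrimitive (Icc 0 1) (fun s t => edgeCocycle (Pi.single e 1 : cell C 1 → ZMod 2)
      (map 2 p (squareLoop s)) (map 2 p (squareLoop t))) fun _ => 0 := by
    intro z _
    refine ⟨univ, Filter.univ_mem, fun x _ y _ => ?_⟩
    simp only [edgeCocycle]
    rw [Finset.sum_eq_single e, hcol, hcol, h00, mul_zero, add_zero]
    · intro e' _ he'
      rw [Pi.single_eq_of_ne he', zero_mul]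
    · simp
  have := hF.add_eq_add isPreconnected_Icc h0 (x := 0) (y := 1) (by simp) (by simp)
  rw [add_zero, add_zero] at this
  rw [Finset.sum_eq_single e, Pi.single_eq_same, one_mul] at hF01
  · rw [← hF01, zmod_two_add_eq_zero_iff, this]
  · intro e' _ he'
    rw [Pi.single_eq_of_ne he', zero_mul]
  · simp

omit [CWComplex.Finite C] in
theorem endCount_eq_zero (A : Subcomplex C) {e : cell C 1} (he : e ∈ A.I 1) {v : cell C 0}
    (hv : v ∉ A.I 0) : endCount C e v = 0 := by
  have h : ∀ σ : ℝ, |σ| = 1 → map 1 e (fun _ => σ) ∉ closedCell 0 v := by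
    intro σ hσ hc
    have h1 : map 1 e (fun _ => σ) ∈ (A : Set X) := A.closedCell_subset_of_mem he
      ⟨_, Metric.sphere_subset_closedBall (const_mem_sphere hσ), rfl⟩
    rw [CWComplex.closedCell_zero_eq_singleton, ← CWComplex.openCell_zero_eq_singleton] at hc
    exact (A.disjoint_openCell_subcomplex_of_not_mem hv).le_bot ⟨hc, h1⟩
  simp [endCount, h (-1) (by simp), h 1 (by simp)]

/-- If all Alexander–Spanier one-cocycles on a finite CW complex have primitives, then its cellular
cohomology in degree one vanishes: a cellular cocycle gives a double cover of the two-skeleton,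
which extends over the cells of dimension at least three. -/
theorem exists_eq_add_of_cocycle
    (hprim : ∀ φ : X → X → ZMod 2, IsLocCocycle C φ → ∃ f, IsLocPrimitive C φ f)
    (hc : ∀ p : cell C 2, ∑ e, c e * (windingCount C p e : ZMod 2) = 0) :
    ∃ s : cell C 0 → ZMod 2, ∀ e, c e = s (tail e) + s (head e) := by
  have hext : ∀ n, ∃ φ, IsLocCocycle (skel C (n + 2)) φ ∧
      ∀ x ∈ skel C 2, ∀ y ∈ skel C 2, φ x y = edgeCocycle c x y := by
    intro n
    induction n with
    | zero => exact ⟨_, isLocCocycle_edgeCocycle c, fun _ _ _ _ => rfl⟩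
    | succ n ih =>
      obtain ⟨φ, hφ, hφc⟩ := ih
      have hpull : ∀ e : cell C (n + 2), IsLocCocycle (Metric.sphere 0 1)
          fun s t => φ (map (n + 2) e s) (map (n + 2) e t) := fun e =>
        hφ.comap ((continuousOn _ e).mono Metric.sphere_subset_closedBall)
          fun t ht => map_mem_skel C e ht
      obtain ⟨φ', hφ', hφ'φ⟩ := hφ.exists_extension fun e => by
        match n with
        | 0 =>
          obtain ⟨F, hF, hF01⟩ := exists_isLocPrimitive_attaching c e
          rw [hc e, zmod_two_add_eq_zero_iff] at hF01
          refine (hpull e).exists_isLocPrimitive_square (F := F) (hF.congr ?_ fun _ _ => rfl) hF01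
          intro s _ t _
          exact hφc _ (map_squareLoop_mem_skel e s) _ (map_squareLoop_mem_skel e t)
        | m + 1 => exact (hpull e).exists_isLocPrimitive_sphere m
      have hsub : skel C 2 ⊆ skel C (n + 2) := skel_mono C (by omega)
      exact ⟨φ', hφ', fun x hx y hy => by rw [hφ'φ x (hsub hx) y (hsub hy), hφc x hx y hy]⟩
  obtain ⟨N, hN⟩ := exists_skel_eq C
  obtain ⟨φ, hφ, hφc⟩ := hext N
  rw [hN _ (by omega)] at hφ
  obtain ⟨f, hf⟩ := hprim φ hφ
  have hf2 : IsLocPrimitive (skel C 2) (edgeCocycle c) f :=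
    (hf.mono (skel_subset C 2)).congr (fun x hx y hy => (hφc x hx y hy).symm) fun _ _ => rfl
  exact ⟨fun v => f (map 0 v ![]), eq_add_of_isLocPrimitive c hf2⟩

/-- Cellular cohomology in degree zero of a connected complex: a function on the vertices which
takes the same values at the ends of each edge is constant. -/
theorem eq_of_tail_eq_head (hC : IsPreconnected C) (s : cell C 0 → ZMod 2)
    (hs : ∀ e : cell C 1, s (tail e) = s (head e)) (v w : cell C 0) : s v = s w := by
  classical
  have hv1 : ∀ v : cell C 0, map 0 v ![] ∈ skel C 1 := fun v =>
    map_mem_skel_succ C v (by simp [Matrix.empty_eq])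
  -- `s` extends to a locally constant function on all skeleta
  have hext : ∀ n, ∃ f, IsLocPrimitive (skel C (n + 2)) (fun _ _ => 0) f ∧
      ∀ v, f (map 0 v ![]) = s v := by
    intro n
    induction n with
    | zero =>
      obtain ⟨f, hf, hfs⟩ := exists_isLocPrimitive_of_coboundary (C := C) (fun _ => 0) s
        fun e => by rw [hs, CharTwo.add_self_eq_zero]
      exact ⟨f, hf.congr (fun x _ y _ => by simp [edgeCocycle]) fun _ _ => rfl, hfs⟩
    | succ n ih =>
      obtain ⟨f, hf, hfs⟩ := ih
      set pole : Fin (n + 2) → ℝ := fun _ => 1 with hpole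
      have hpoles : pole ∈ Metric.sphere (0 : Fin (n + 2) → ℝ) 1 := by
        rw [mem_sphere_zero_iff_norm, hpole, pi_norm_const, norm_one]
      set f' : X → ZMod 2 := fun x => if hx : ∃ e, x ∈ openCell (C := C) (n + 2) e then
        f (map (n + 2) hx.choose pole) else f x with hf'
      have hskel : ∀ x ∈ skel C (n + 2), f' x = f x := by
        intro x hx
        refine dif_neg ?_
        rintro ⟨e, he⟩
        exact notMem_openCell_of_mem_skel C le_rfl hx e he
      have hcell : ∀ (e : cell C (n + 2)) (t : Fin (n + 2) → ℝ), t ∈ Metric.closedBall 0 1 →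
          f' (map (n + 2) e t) = f (map (n + 2) e pole) := by
        intro e t ht
        rcases mem_sphere_or_mem_ball ht with hts | htb
        · rw [hskel _ (map_mem_skel C e hts)]
          have hconn : IsPreconnected (Metric.sphere (0 : Fin (n + 2) → ℝ) 1) := by
            refine isPreconnected_sphere ?_ 0 1
            rw [rank_fun', Fintype.card_fin]
            exact_mod_cast (by omega : 1 < n + 2)
          have h1 := hf.comap ((continuousOn _ e).mono Metric.sphere_subset_closedBall)
            (T := Metric.sphere 0 1) fun t ht => map_mem_skel C e ht
          have h2 : IsLocPrimitive (Metric.sphere (0 : Fin (n + 2) → ℝ) 1) (fun _ _ => 0)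
              fun _ => 0 := fun _ _ => ⟨univ, Filter.univ_mem, by simp⟩
          simpa using h1.add_eq_add hconn h2 hts hpoles
        · have h1 : ∃ e', map (n + 2) e t ∈ openCell (C := C) (n + 2) e' := ⟨e, t, htb, rfl⟩
          have h2 : h1.choose = e := by
            obtain ⟨u, hu, hut⟩ := h1.choose_spec
            exact (eq_of_map_eq C hu ht hut.symm).1.symm
          simp only [hf', dif_pos h1, h2]
      have hzero : IsLocCocycle (skel C (n + 2 + 1)) fun _ _ => 0 :=
        fun _ _ => ⟨univ, Filter.univ_mem, by simp⟩
      refine ⟨f', hzero.isLocPrimitive fun z hz => ?_, fun v => ?_⟩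
      · refine mem_nhdsWithin_skel_succ (fun hz1 => ?_) ?_
        · obtain ⟨U, hU, hUc⟩ := hf z hz1
          filter_upwards [hU, self_mem_nhdsWithin] with x hx hxs
          rw [hskel x hxs, hskel z hz1]
          exact hUc x hx z (mem_of_mem_nhdsWithin hz1 hU)
        · rintro e t ht rfl
          filter_upwards [self_mem_nhdsWithin] with t' ht'
          rw [mem_preimage, mem_ofPred_eq, hcell e t' ht', hcell e t ht, CharTwo.add_self_eq_zero]
      · rw [hskel _ (skel_mono C (by omega) (hv1 v)), hfs]
  obtain ⟨N, hN⟩ := exists_skel_eq C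
  obtain ⟨f, hf, hfs⟩ := hext N
  rw [hN _ (by omega)] at hf
  have hzero : IsLocPrimitive C (fun _ _ => 0) fun _ => 0 :=
    fun _ _ => ⟨univ, Filter.univ_mem, by simp⟩
  have hvC : ∀ v : cell C 0, map 0 v ![] ∈ C := fun v => skel_subset C 1 (hv1 v)
  rw [← hfs v, ← hfs w]
  simpa using hf.add_eq_add hC hzero (hvC v) (hvC w)

/-- A nonempty CW complex has a vertex. -/
theorem nonempty_cell_zero (hC : C.Nonempty) : Nonempty (cell C 0) := by
  by_contra h
  rw [not_nonempty_iff] at h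
  have hempty : ∀ n, skel C n = ∅ := by
    intro n
    induction n with
    | zero => exact skel_zero C
    | succ n ih =>
      rw [skel_succ, ih, empty_union, iUnion_eq_empty]
      intro e
      rcases Nat.eq_zero_or_pos n with rfl | hn
      · exact h.elim e
      · obtain ⟨x, t, ht, -⟩ := CWComplex.nonempty_cellFrontier hn.ne' e
        have := map_mem_skel C e ht
        rw [ih] at this
        exact this.elim
  obtain ⟨N, hN⟩ := exists_skel_eq C
  rw [← hN N le_rfl, hempty] at hC
  exact not_nonempty_empty hC

end Edges

/-! ### Dimension counts for relative homology -/

section LinearAlgebra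

open Module Submodule LinearMap

variable {K : Type*} [Field K]

theorem finrank_map_add_finrank_inf_ker {E F : Type*} [AddCommGroup E] [Module K E]
    [FiniteDimensional K E] [AddCommGroup F] [Module K F] (f : E →ₗ[K] F) (S : Submodule K E) :
    finrank K (S.map f) + finrank K (S ⊓ LinearMap.ker f : Submodule K E) = finrank K S := by
  have h := LinearMap.finrank_range_add_finrank_ker (f.domRestrict S)
  rw [LinearMap.range_domRestrict, LinearMap.ker_domRestrict] at h
  rw [← h, ← Submodule.finrank_map_subtype_eq S, Submodule.map_comap_subtype]

theorem finrank_quotient_comap_subtype {E : Type*} [AddCommGroup E] [Module K E]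
    [FiniteDimensional K E] {W Z : Submodule K E} (h : W ≤ Z) :
    finrank K (Z ⧸ W.comap Z.subtype) + finrank K W = finrank K Z := by
  rw [← LinearEquiv.finrank_eq (Submodule.comapSubtypeEquivOfLe h)]
  exact Submodule.finrank_quotient_add_finrank _

theorem mem_ker_sum_proj {ι : Type*} [Fintype ι] {x : ι → K} :
    x ∈ LinearMap.ker (∑ i : ι, LinearMap.proj (R := K) (φ := fun _ => K) i) ↔
      ∑ i, x i = 0 := by
  rw [LinearMap.mem_ker, LinearMap.sum_apply]
  rfl

theorem finrank_ker_sum_proj {ι : Type*} [Fintype ι] (i₀ : ι) :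
    finrank K (LinearMap.ker (∑ i : ι, LinearMap.proj (R := K) (φ := fun _ => K) i)) + 1 =
      Fintype.card ι := by
  classical
  have hs : LinearMap.range (∑ i : ι, LinearMap.proj (R := K) (φ := fun _ => K) i) = ⊤ := by
    refine LinearMap.range_eq_top.2 fun a => ⟨Pi.single i₀ a, ?_⟩
    simp
  have := LinearMap.finrank_range_add_finrank_ker
    (∑ i : ι, LinearMap.proj (R := K) (φ := fun _ => K) i)
  rw [hs, finrank_top, Module.finrank_self, Module.finrank_fintype_fun_eq_card] at this
  omega

/-- The count of dimensions in the long exact sequence of a pair in degree one. The subcomplex has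
one-chains `i : E' → E` and zero-chains `j : V' → V`, and `W` is the space of boundaries in `E`. -/
theorem finrank_relative_cycles {E V E' V' : Type*} [AddCommGroup E] [Module K E]
    [FiniteDimensional K E] [AddCommGroup V] [Module K V] [FiniteDimensional K V]
    [AddCommGroup E'] [Module K E'] [FiniteDimensional K E'] [AddCommGroup V'] [Module K V']
    [FiniteDimensional K V'] (d : E →ₗ[K] V) (d' : E' →ₗ[K] V') (i : E' →ₗ[K] E)
    (j : V' →ₗ[K] V) (hi : Function.Injective i) (hj : Function.Injective j)
    (hd : ∀ x, d (i x) = j (d' x)) {W : Submodule K E} (hW : W ≤ LinearMap.ker d) :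
    (finrank K ((LinearMap.range j).comap d) : ℤ) -
        finrank K (W ⊔ LinearMap.range i : Submodule K E) =
      finrank K (LinearMap.ker d) - finrank K W -
        finrank K (((LinearMap.ker d').map i).map W.mkQ) +
        finrank K (LinearMap.range j ⊓ LinearMap.range d : Submodule K V) -
        finrank K (LinearMap.range d') := by
  have h1 := finrank_map_add_finrank_inf_ker d ((LinearMap.range j).comap d)
  have e1 : ((LinearMap.range j).comap d) ⊓ LinearMap.ker d = LinearMap.ker d := by
    rw [inf_eq_right]
    intro x hx
    rw [Submodule.mem_comap, LinearMap.mem_ker.1 hx]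
    exact zero_mem _
  rw [Submodule.map_comap_eq, e1, inf_comm] at h1
  have h2 := Submodule.finrank_sup_add_finrank_inf_eq W (LinearMap.range i)
  have h3 := finrank_map_add_finrank_inf_ker W.mkQ ((LinearMap.ker d').map i)
  have e3 : (LinearMap.ker d').map i = LinearMap.range i ⊓ LinearMap.ker d := by
    ext x
    constructor
    · rintro ⟨y, hy, rfl⟩
      refine ⟨⟨y, rfl⟩, ?_⟩
      have hy' : d' y = 0 := hy
      change d (i y) = 0
      rw [hd, hy', map_zero]
    · rintro ⟨⟨y, rfl⟩, hy⟩
      refine ⟨y, ?_, rfl⟩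
      have hy' : d (i y) = 0 := hy
      rw [hd] at hy'
      exact hj (by rw [hy', map_zero])
  have e4 : (LinearMap.ker d').map i ⊓ LinearMap.ker W.mkQ = W ⊓ LinearMap.range i := by
    rw [Submodule.ker_mkQ, e3, inf_assoc, inf_eq_right.2 hW, inf_comm]
  have e5 : finrank K ((LinearMap.ker d').map i) = finrank K (LinearMap.ker d') :=
    (LinearEquiv.finrank_eq (Submodule.equivMapOfInjective i hi _)).symm
  rw [e4, e5] at h3
  have h6 := LinearMap.finrank_range_add_finrank_ker d'
  have h7 := LinearMap.finrank_range_of_inj hi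
  omega

end LinearAlgebra

section Homology

open Module

variable {X : Type*} [TopologicalSpace X] [T2Space X] {C : Set X} [CWComplex C]
  [CWComplex.Finite C]

attribute [local instance] fintypeCell

omit [T2Space X] in
theorem boundary₁_apply (x : cell C 1 → ZMod 2) (v : cell C 0) :
    boundary₁ C x v = ∑ e, (endCount C e v : ZMod 2) * x e := rfl

omit [T2Space X] in
theorem boundary₂_apply (y : cell C 2 → ZMod 2) (e : cell C 1) :
    boundary₂ C y e = ∑ p, (windingCount C p e : ZMod 2) * y p := rfl

theorem sum_endCount_mul_windingCount (p : cell C 2) (v : cell C 0) :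
    ∑ e, (endCount C e v : ZMod 2) * (windingCount C p e : ZMod 2) = 0 := by
  classical
  refine sum_mul_windingCount_eq_zero (fun e => (endCount C e v : ZMod 2)) (Pi.single v 1)
    (fun e => ?_) p
  rw [← sum_endCount_mul]
  simp [Pi.single_apply]

theorem range_boundary₂_le_ker : LinearMap.range (boundary₂ C) ≤ LinearMap.ker (boundary₁ C) := by
  rintro _ ⟨y, rfl⟩
  rw [LinearMap.mem_ker]
  funext v
  simp only [boundary₁_apply, boundary₂_apply, Finset.mul_sum, Pi.zero_apply]
  rw [Finset.sum_comm]
  refine Finset.sum_eq_zero fun p _ => ?_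
  simp only [← mul_assoc]
  rw [← Finset.sum_mul, sum_endCount_mul_windingCount, zero_mul]

theorem betti₁_add_finrank :
    betti₁ C + finrank (ZMod 2) (LinearMap.range (boundary₂ C)) =
      finrank (ZMod 2) (LinearMap.ker (boundary₁ C)) :=
  finrank_quotient_comap_subtype range_boundary₂_le_ker

omit [T2Space X] in
theorem betti₀_add_finrank :
    betti₀ C + finrank (ZMod 2) (LinearMap.range (boundary₁ C)) = Fintype.card (cell C 0) := by
  rw [← Module.finrank_fintype_fun_eq_card (ZMod 2)]
  exact Submodule.finrank_quotient_add_finrank _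

theorem betti₀_eq_one (hC : IsConnected C) : betti₀ C = 1 := by
  obtain ⟨v₀⟩ := nonempty_cell_zero hC.nonempty
  -- the kernel of the transpose of the boundary operator consists of the constant functions
  have hker : LinearMap.ker (Matrix.of fun (v : cell C 0) (e : cell C 1) =>
      (endCount C e v : ZMod 2)).transpose.mulVecLin =
      Submodule.span (ZMod 2) {fun _ : cell C 0 => (1 : ZMod 2)} := by
    have happ : ∀ (s : cell C 0 → ZMod 2) (e : cell C 1),
        (Matrix.of fun (v : cell C 0) (e : cell C 1) =>
          (endCount C e v : ZMod 2)).transpose.mulVecLin s e = s (tail e) + s (head e) :=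
      fun s e => sum_endCount_mul e s
    ext s
    rw [LinearMap.mem_ker, Submodule.mem_span_singleton]
    constructor
    · intro hs
      refine ⟨s v₀, funext fun v => ?_⟩
      rw [Pi.smul_apply, smul_eq_mul, mul_one]
      refine eq_of_tail_eq_head hC.isPreconnected s (fun e => ?_) v₀ v
      rw [← zmod_two_add_eq_zero_iff, ← happ, hs]
      rfl
    · rintro ⟨a, rfl⟩
      funext e
      rw [happ]
      simp [CharTwo.add_self_eq_zero]
  have h1 : finrank (ZMod 2) (LinearMap.range (boundary₁ C)) = (Matrix.of fun (v : cell C 0)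
    (e : cell C 1) => (endCount C e v : ZMod 2)).rank := rfl
  have h2 := LinearMap.finrank_range_add_finrank_ker (Matrix.of fun (v : cell C 0) (e : cell C 1) =>
      (endCount C e v : ZMod 2)).transpose.mulVecLin
  have hne : (fun _ : cell C 0 => (1 : ZMod 2)) ≠ 0 := fun h => one_ne_zero (congrFun h v₀)
  rw [hker, finrank_span_singleton hne, Module.finrank_fintype_fun_eq_card] at h2
  have h3 := Matrix.rank_transpose (Matrix.of fun (v : cell C 0) (e : cell C 1) =>
      (endCount C e v : ZMod 2))
  rw [Matrix.rank] at h3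
  have h4 := betti₀_add_finrank (C := C)
  omega

/-- In a connected complex the boundaries are the zero-chains with an even number of vertices. -/
theorem range_boundary₁_eq_ker (hC : IsConnected C) : LinearMap.range (boundary₁ C) =
    LinearMap.ker (∑ v : cell C 0, LinearMap.proj (R := ZMod 2) (φ := fun _ => ZMod 2) v) := by
  obtain ⟨v₀⟩ := nonempty_cell_zero hC.nonempty
  refine Submodule.eq_of_le_of_finrank_eq ?_ ?_
  · rintro _ ⟨x, rfl⟩
    rw [mem_ker_sum_proj]
    simp only [boundary₁_apply]
    rw [Finset.sum_comm]
    refine Finset.sum_eq_zero fun e _ => ?_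
    rw [← Finset.sum_mul]
    have := sum_endCount_mul e (fun _ : cell C 0 => (1 : ZMod 2))
    simp only [mul_one] at this
    rw [this, CharTwo.add_self_eq_zero, zero_mul]
  · have h1 := betti₀_add_finrank (C := C)
    rw [betti₀_eq_one hC] at h1
    have h2 := finrank_ker_sum_proj (K := ZMod 2) v₀
    omega

variable (A : Subcomplex C)

/-- Extension of chains of the subcomplex `A` by zero. -/
def extend (n : ℕ) : (A.I n → ZMod 2) →ₗ[ZMod 2] (cell C n → ZMod 2) :=
  Function.ExtendByZero.linearMap (ZMod 2) Subtype.val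

/-- Restriction of chains to the cells which are not in the subcomplex `A`. -/
def restrictBulk (n : ℕ) : (cell C n → ZMod 2) →ₗ[ZMod 2] (BulkCell A n → ZMod 2) :=
  LinearMap.funLeft (ZMod 2) (ZMod 2) Subtype.val

omit [T2Space X] [CWComplex.Finite C] in
theorem extend_injective (n : ℕ) : Function.Injective (extend A n) :=
  Function.extend_injective Subtype.val_injective _

omit [T2Space X] [CWComplex.Finite C] in
theorem restrictBulk_surjective (n : ℕ) : Function.Surjective (restrictBulk A n) :=
  LinearMap.funLeft_surjective_of_injective _ _ _ Subtype.val_injective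

omit [T2Space X] [CWComplex.Finite C] in
theorem extend_apply_of_mem {n : ℕ} (x : A.I n → ZMod 2) {i : cell C n} (hi : i ∈ A.I n) :
    extend A n x i = x ⟨i, hi⟩ :=
  Subtype.val_injective.extend_apply x 0 (⟨i, hi⟩ : A.I n)

omit [T2Space X] [CWComplex.Finite C] in
theorem extend_apply_of_notMem {n : ℕ} (x : A.I n → ZMod 2) {i : cell C n} (hi : i ∉ A.I n) :
    extend A n x i = 0 :=
  Function.extend_apply' _ _ _ fun ⟨a, ha⟩ => hi (ha ▸ a.2)

omit [T2Space X] [CWComplex.Finite C] in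
theorem ker_restrictBulk (n : ℕ) :
    LinearMap.ker (restrictBulk A n) = LinearMap.range (extend A n) := by
  ext x
  constructor
  · intro hx
    refine ⟨fun i => x i, funext fun i => ?_⟩
    by_cases hi : i ∈ A.I n
    · exact extend_apply_of_mem A _ hi
    · rw [extend_apply_of_notMem A _ hi]
      exact (congrFun (LinearMap.mem_ker.1 hx) (⟨i, hi⟩ : BulkCell A n)).symm
  · rintro ⟨y, rfl⟩
    exact funext fun i => extend_apply_of_notMem A y i.2

theorem sum_extend {n : ℕ} (a : cell C n → ZMod 2) (y : A.I n → ZMod 2) :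
    ∑ i : cell C n, a i * extend A n y i = ∑ i : cell (A : Set X) n, a i.1 * y i :=
  (Fintype.sum_of_injective (fun i : cell (A : Set X) n => i.1) Subtype.val_injective
    (fun i => a i.1 * y i) (fun i => a i * extend A n y i)
    (fun i hi => by
      rw [extend_apply_of_notMem A y (fun h => hi ⟨⟨i, h⟩, rfl⟩), mul_zero])
    (fun i => by rw [extend_apply_of_mem A y i.2]; rfl)).symm

theorem boundary₁_extend (y : A.I 1 → ZMod 2) :
    boundary₁ C (extend A 1 y) = extend A 0 (boundary₁ (A : Set X) y) := by
  funext v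
  rw [boundary₁_apply, sum_extend A (fun e => (endCount C e v : ZMod 2))]
  by_cases hv : v ∈ A.I 0
  · rw [extend_apply_of_mem A _ hv]
    rfl
  · rw [extend_apply_of_notMem A _ hv]
    refine Finset.sum_eq_zero fun e _ => ?_
    rw [endCount_eq_zero A e.2 hv, Nat.cast_zero, zero_mul]

omit [T2Space X] in
theorem sum_bulk {n : ℕ} (a : cell C n → ZMod 2) (ha : ∀ i ∈ A.I n, a i = 0) :
    ∑ i : BulkCell A n, a i.1 = ∑ i, a i :=
  Fintype.sum_of_injective (fun i : BulkCell A n => i.1) Subtype.val_injective _ _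
    (fun i hi => ha i (by
      by_contra h
      exact hi ⟨⟨i, h⟩, rfl⟩)) fun _ => rfl

/-- The matrix of the relative boundary operator `C₁(C, A) → C₀(C, A)`. -/
def relBoundary₁ : Matrix (BulkCell A 0) (BulkCell A 1) (ZMod 2) :=
  Matrix.of fun v e => (endCount C e.1 v.1 : ZMod 2)

/-- The matrix of the relative boundary operator `C₂(C, A) → C₁(C, A)`. -/
def relBoundary₂ : Matrix (BulkCell A 1) (BulkCell A 2) (ZMod 2) :=
  Matrix.of fun e p => (windingCount C p.1 e.1 : ZMod 2)

theorem restrictBulk_comp_boundary₁ :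
    (restrictBulk A 0).comp (boundary₁ C) = (relBoundary₁ A).mulVecLin.comp (restrictBulk A 1) := by
  refine LinearMap.ext fun x => funext fun v => ?_
  refine (sum_bulk A (fun e => (endCount C e v.1 : ZMod 2) * x e) fun e he => ?_).symm
  rw [endCount_eq_zero A he v.2, Nat.cast_zero, zero_mul]

theorem restrictBulk_comp_boundary₂ :
    (restrictBulk A 1).comp (boundary₂ C) = (relBoundary₂ A).mulVecLin.comp (restrictBulk A 2) := by
  refine LinearMap.ext fun x => funext fun e => ?_
  refine (sum_bulk A (fun p => (windingCount C p e.1 : ZMod 2) * x p) fun p hp => ?_).symm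
  rw [windingCount_eq_zero A hp e.2, zero_mul]

/-- The relative one-cocycles: configurations on the bulk edges which are annihilated by all
plaquettes. -/
def relCocycles : Submodule (ZMod 2) (BulkCell A 1 → ZMod 2) :=
  LinearMap.ker (relBoundary₂ A).transpose.mulVecLin

/-- The relative one-coboundaries: the configurations generated by the stars. -/
def relCoboundaries : Submodule (ZMod 2) (BulkCell A 1 → ZMod 2) :=
  LinearMap.range (relBoundary₁ A).transpose.mulVecLin

omit [T2Space X] in
theorem mem_relCocycles {s : BulkCell A 1 → ZMod 2} :
    s ∈ relCocycles A ↔ ∀ p : BulkCell A 2, ∑ e, (windingCount C p.1 e.1 : ZMod 2) * s e = 0 :=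
  LinearMap.mem_ker.trans funext_iff

omit [T2Space X] in
theorem relCoboundaries_eq_span : relCoboundaries A =
    Submodule.span (ZMod 2) (range fun (v : BulkCell A 0) (e : BulkCell A 1) =>
      (endCount C e.1 v.1 : ZMod 2)) :=
  Matrix.range_mulVecLin _

theorem relCoboundaries_le : relCoboundaries A ≤ relCocycles A := by
  rw [relCoboundaries_eq_span, Submodule.span_le]
  rintro _ ⟨v, rfl⟩
  refine (mem_relCocycles A).2 fun p => ?_
  rw [sum_bulk A (fun e => (windingCount C p.1 e : ZMod 2) * (endCount C e v.1 : ZMod 2))]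
  · simp only [mul_comm (windingCount C p.1 _ : ZMod 2)]
    exact sum_endCount_mul_windingCount p.1 v.1
  · intro e he
    rw [endCount_eq_zero A he v.2, Nat.cast_zero, mul_zero]

/-- The dimension of relative cohomology equals the dimension of relative homology, where the
latter is written as a subquotient of the one-chains of the whole complex. -/
theorem finrank_relCocycles_sub : (finrank (ZMod 2) (relCocycles A) : ℤ) -
    finrank (ZMod 2) (relCoboundaries A) =
      finrank (ZMod 2) ((LinearMap.range (extend A 0)).comap (boundary₁ C)) -
        finrank (ZMod 2) (LinearMap.range (boundary₂ C) ⊔ LinearMap.range (extend A 1) :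
          Submodule (ZMod 2) (cell C 1 → ZMod 2)) := by
  have hK := LinearMap.finrank_range_add_finrank_ker (relBoundary₂ A).transpose.mulVecLin
  have hR2 : finrank (ZMod 2) (LinearMap.range (relBoundary₂ A).transpose.mulVecLin) =
    finrank (ZMod 2) (LinearMap.range (relBoundary₂ A).mulVecLin) := Matrix.rank_transpose _
  have hR1 : finrank (ZMod 2) (relCoboundaries A) =
    finrank (ZMod 2) (LinearMap.range (relBoundary₁ A).mulVecLin) := Matrix.rank_transpose _
  have hZ := LinearMap.finrank_range_add_finrank_ker ((restrictBulk A 0).comp (boundary₁ C))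
  rw [LinearMap.ker_comp, ker_restrictBulk, restrictBulk_comp_boundary₁,
    LinearMap.range_comp_of_range_eq_top _
      (LinearMap.range_eq_top.2 (restrictBulk_surjective A 1))] at hZ
  have hW := finrank_map_add_finrank_inf_ker (restrictBulk A 1)
    (LinearMap.range (boundary₂ C) ⊔ LinearMap.range (extend A 1))
  rw [ker_restrictBulk, inf_eq_right.2 le_sup_right, Submodule.map_sup, ← LinearMap.range_comp,
    restrictBulk_comp_boundary₂, LinearMap.range_comp_of_range_eq_top _
      (LinearMap.range_eq_top.2 (restrictBulk_surjective A 2)), ← ker_restrictBulk,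
    (LinearMap.le_ker_iff_map (f := restrictBulk A 1)).1 le_rfl, sup_bot_eq] at hW
  have hE := LinearMap.finrank_range_add_finrank_ker (restrictBulk A 1)
  rw [LinearMap.range_eq_top.2 (restrictBulk_surjective A 1), finrank_top] at hE
  rw [← ker_restrictBulk A 1]
  unfold relCocycles
  omega

/-- The long exact sequence of the pair `(C, A)` as an identity of dimensions. -/
theorem finrank_relCocycles_sub_eq : (finrank (ZMod 2) (relCocycles A) : ℤ) -
    finrank (ZMod 2) (relCoboundaries A) = betti₁ C - betti₁NT A +
      finrank (ZMod 2) (LinearMap.range (extend A 0) ⊓ LinearMap.range (boundary₁ C) :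
        Submodule (ZMod 2) (cell C 0 → ZMod 2)) -
      finrank (ZMod 2) (LinearMap.range (boundary₁ (A : Set X))) := by
  have h := finrank_relative_cycles (boundary₁ C) (boundary₁ (A : Set X)) (extend A 1) (extend A 0)
    (extend_injective A 1) (extend_injective A 0) (boundary₁_extend A) range_boundary₂_le_ker
  have hb := betti₁_add_finrank (C := C)
  have hNT : betti₁NT A = finrank (ZMod 2) (((LinearMap.ker (boundary₁ (A : Set X))).map
    (extend A 1)).map (LinearMap.range (boundary₂ C)).mkQ) := rfl
  rw [finrank_relCocycles_sub, hNT]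
  omega

theorem finrank_relCocycles_sub_of_eq_empty (hA : (A : Set X) = ∅) :
    (finrank (ZMod 2) (relCocycles A) : ℤ) - finrank (ZMod 2) (relCoboundaries A) = betti₁ C := by
  have hI : ∀ n, IsEmpty (A.I n) := fun n => ⟨fun i => by
    obtain ⟨x, hx⟩ := RelCWComplex.openCell_nonempty n i.1
    have := A.openCell_subset_of_mem i.2 hx
    rw [hA] at this
    exact this⟩
  have h0 := hI 0
  have h1 := hI 1
  have hr0 : LinearMap.range (extend A 0) = ⊥ := by
    rw [LinearMap.range_eq_bot]
    exact LinearMap.ext fun x => by rw [Subsingleton.elim x 0, map_zero, map_zero]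
  have hr1 : LinearMap.range (extend A 1) = ⊥ := by
    rw [LinearMap.range_eq_bot]
    exact LinearMap.ext fun x => by rw [Subsingleton.elim x 0, map_zero, map_zero]
  rw [finrank_relCocycles_sub, hr0, hr1, sup_bot_eq, Submodule.comap_bot,
    ← betti₁_add_finrank (C := C)]
  push_cast
  ring

theorem finrank_relCocycles_sub_of_nonempty (hC : IsConnected C) (hA : (A : Set X).Nonempty) :
    (finrank (ZMod 2) (relCocycles A) : ℤ) - finrank (ZMod 2) (relCoboundaries A) =
      betti₀ (A : Set X) - 1 + betti₁ C - betti₁NT A := by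
  obtain ⟨v₀⟩ := nonempty_cell_zero hA
  -- zero-chains of `A` which are boundaries in `C` are those with an even number of vertices
  have h1 : finrank (ZMod 2) (LinearMap.range (extend A 0) ⊓ LinearMap.range (boundary₁ C) :
      Submodule (ZMod 2) (cell C 0 → ZMod 2)) + 1 = Fintype.card (cell (A : Set X) 0) := by
    rw [← finrank_ker_sum_proj (K := ZMod 2) v₀, range_boundary₁_eq_ker hC]
    congr 1
    refine (LinearEquiv.finrank_eq ((Submodule.equivMapOfInjective (extend A 0)
      (extend_injective A 0) _).trans (LinearEquiv.ofEq _ _ ?_))).symm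
    have hsum : ∀ y : A.I 0 → ZMod 2, ∑ v, extend A 0 y v = ∑ v : cell (A : Set X) 0, y v :=
      fun y => by simpa using sum_extend A (fun _ => 1) y
    ext x
    constructor
    · rintro ⟨y, hy, rfl⟩
      refine ⟨⟨y, rfl⟩, ?_⟩
      rw [SetLike.mem_coe, mem_ker_sum_proj, hsum]
      exact mem_ker_sum_proj.1 hy
    · rintro ⟨⟨y, rfl⟩, hy⟩
      refine ⟨y, mem_ker_sum_proj.2 ?_, rfl⟩
      rw [SetLike.mem_coe, mem_ker_sum_proj, hsum] at hy
      exact hy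
  have h2 := betti₀_add_finrank (C := (A : Set X))
  rw [finrank_relCocycles_sub_eq]
  omega

/-- If all Alexander–Spanier one-cocycles have primitives, then so do the cellular ones, and the
first Betti number vanishes. -/
theorem betti₁_eq_zero
    (hprim : ∀ φ : X → X → ZMod 2, IsLocCocycle C φ → ∃ f, IsLocPrimitive C φ f) :
    betti₁ C = 0 := by
  set M₁ : Matrix (cell C 0) (cell C 1) (ZMod 2) := Matrix.of fun v e =>
    (endCount C e v : ZMod 2) with hM₁
  set M₂ : Matrix (cell C 1) (cell C 2) (ZMod 2) := Matrix.of fun e p =>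
    (windingCount C p e : ZMod 2) with hM₂
  have hle : LinearMap.ker M₂.transpose.mulVecLin ≤ LinearMap.range M₁.transpose.mulVecLin := by
    intro c hc
    have hc' : ∀ p : cell C 2, ∑ e, c e * (windingCount C p e : ZMod 2) = 0 := fun p => by
      simp only [mul_comm (c _)]
      exact congrFun (LinearMap.mem_ker.1 hc) p
    obtain ⟨s, hs⟩ := exists_eq_add_of_cocycle c hprim hc'
    exact ⟨s, funext fun e => (sum_endCount_mul e s).trans (hs e).symm⟩
  have h1 := Submodule.finrank_mono hle
  have h2 := LinearMap.finrank_range_add_finrank_ker M₂.transpose.mulVecLin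
  have h3 : finrank (ZMod 2) (LinearMap.range M₂.transpose.mulVecLin) =
    finrank (ZMod 2) (LinearMap.range (boundary₂ C)) := Matrix.rank_transpose _
  have h4 : finrank (ZMod 2) (LinearMap.range M₁.transpose.mulVecLin) =
    finrank (ZMod 2) (LinearMap.range (boundary₁ C)) := Matrix.rank_transpose _
  have h5 := LinearMap.finrank_range_add_finrank_ker (boundary₁ C)
  have h6 := betti₁_add_finrank (C := C)
  omega

theorem betti₁NT_le : betti₁NT A ≤ betti₁ C := by
  have hle : (LinearMap.ker (boundary₁ (A : Set X))).map (extend A 1) ≤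
      LinearMap.ker (boundary₁ C) := by
    rintro _ ⟨y, hy, rfl⟩
    have hy' : boundary₁ (A : Set X) y = 0 := hy
    rw [LinearMap.mem_ker, boundary₁_extend, hy', map_zero]
  have h1 := Submodule.finrank_mono
    (Submodule.map_mono (f := (LinearMap.range (boundary₂ C)).mkQ) hle)
  have h2 := finrank_map_add_finrank_inf_ker (LinearMap.range (boundary₂ C)).mkQ
    (LinearMap.ker (boundary₁ C))
  rw [Submodule.ker_mkQ, inf_eq_right.2 range_boundary₂_le_ker] at h2
  have h3 := betti₁_add_finrank (C := C)
  have hNT : betti₁NT A = finrank (ZMod 2) (((LinearMap.ker (boundary₁ (A : Set X))).map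
    (extend A 1)).map (LinearMap.range (boundary₂ C)).mkQ) := rfl
  omega

end Homology

/-! ### Pauli strings -/

section Pauli

variable {E : Type*}

theorem pauliZ_pow_apply (e : E) (n : ℕ) (ψ : QubitSpace E) (s : E → ZMod 2) :
    (pauliZ e ^ n) ψ s = (-1) ^ (n * (s e).val) * ψ s := by
  induction n with
  | zero => simp
  | succ n ih =>
    rw [pow_succ', Module.End.mul_apply]
    change (-1) ^ (s e).val * (pauliZ e ^ n) ψ s = _
    rw [ih, ← mul_assoc, ← pow_add]
    ring_nf

theorem pauliX_pow_apply [DecidableEq E] (e : E) (n : ℕ) (ψ : QubitSpace E) (s : E → ZMod 2) :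
    (pauliX e ^ n) ψ s = ψ (s + Pi.single e (n : ZMod 2)) := by
  induction n generalizing s with
  | zero => simp
  | succ n ih =>
    rw [pow_succ', Module.End.mul_apply]
    change (pauliX e ^ n) ψ (s + Pi.single e 1) = _
    rw [ih, add_assoc, ← Pi.single_add, Nat.cast_succ, add_comm (1 : ZMod 2)]

variable [Fintype E]

theorem zString_apply (k : E → ℕ) (ψ : QubitSpace E) (s : E → ZMod 2) :
    zString k ψ s = (-1) ^ (∑ e, k e * (s e).val) * ψ s := by
  classical
  have h : ∀ (t : Finset E) (comm : (t : Set E).Pairwise fun e f =>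
      Commute (pauliZ e ^ k e) (pauliZ f ^ k f)),
      t.noncommProd (fun e => pauliZ e ^ k e) comm ψ s =
        (-1) ^ (∑ e ∈ t, k e * (s e).val) * ψ s := by
    intro t
    induction t using Finset.induction_on with
    | empty => intro comm; simp
    | insert a t ha ih =>
      intro comm
      rw [Finset.noncommProd_insert_of_notMem _ _ _ _ ha, Module.End.mul_apply,
        pauliZ_pow_apply, ih, Finset.sum_insert ha, pow_add, mul_assoc]
  exact h Finset.univ _

theorem xString_apply [DecidableEq E] (k : E → ℕ) (ψ : QubitSpace E) (s : E → ZMod 2) :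
    xString k ψ s = ψ (s + fun e => (k e : ZMod 2)) := by
  have h : ∀ (t : Finset E) (comm : (t : Set E).Pairwise fun e f =>
      Commute (pauliX e ^ k e) (pauliX f ^ k f)) (s : E → ZMod 2),
      t.noncommProd (fun e => pauliX e ^ k e) comm ψ s =
        ψ (s + ∑ e ∈ t, Pi.single e (k e : ZMod 2)) := by
    intro t
    induction t using Finset.induction_on with
    | empty => intro comm s; simp
    | insert a t ha ih =>
      intro comm s
      rw [Finset.noncommProd_insert_of_notMem _ _ _ _ ha, Module.End.mul_apply,
        pauliX_pow_apply, ih, Finset.sum_insert ha, add_assoc]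
  refine (h _ _ s).trans ?_
  rw [Finset.univ_sum_single fun e => (k e : ZMod 2)]

theorem norm_zString [DecidableEq E] (k : E → ℕ) (ψ : QubitSpace E) : ‖zString k ψ‖ = ‖ψ‖ := by
  rw [EuclideanSpace.norm_eq, EuclideanSpace.norm_eq]
  simp [zString_apply]

theorem norm_xString [DecidableEq E] (k : E → ℕ) (ψ : QubitSpace E) : ‖xString k ψ‖ = ‖ψ‖ := by
  rw [EuclideanSpace.norm_eq, EuclideanSpace.norm_eq]
  congr 1
  simp only [xString_apply]
  exact Fintype.sum_equiv (Equiv.addRight fun e => (k e : ZMod 2)) _ _ fun s => rfl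

theorem zString_eq_self_iff (k : E → ℕ) (ψ : QubitSpace E) :
    zString k ψ = ψ ↔ ∀ s : E → ZMod 2, ∑ e, (k e : ZMod 2) * s e ≠ 0 → ψ s = 0 := by
  have hcast : ∀ s : E → ZMod 2, ((∑ e, k e * (s e).val : ℕ) : ZMod 2) =
      ∑ e, (k e : ZMod 2) * s e := fun s => by
    push_cast
    simp
  constructor
  · intro h s hs
    have h1 := congrArg (fun φ : QubitSpace E => φ s) h
    simp only [zString_apply] at h1
    rw [← hcast, Ne, ZMod.natCast_eq_zero_iff_even, Nat.not_even_iff_odd] at hs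
    rw [hs.neg_one_pow] at h1
    exact CharZero.neg_eq_self_iff.1 (by simpa using h1)
  · intro h
    ext s
    rw [zString_apply]
    by_cases hs : ∑ e, (k e : ZMod 2) * s e = 0
    · rw [← hcast, ZMod.natCast_eq_zero_iff_even] at hs
      rw [hs.neg_one_pow, one_mul]
    · rw [h s hs, mul_zero]

theorem xString_eq_self_iff [DecidableEq E] (k : E → ℕ) (ψ : QubitSpace E) :
    xString k ψ = ψ ↔ ∀ s : E → ZMod 2, ψ (s + fun e => (k e : ZMod 2)) = ψ s := by
  constructor
  · intro h s
    have h1 := congrArg (fun φ : QubitSpace E => φ s) h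
    simpa only [xString_apply] using h1
  · intro h
    ext s
    rw [xString_apply, h]

end Pauli

/-! ### The code space -/

section CodeSpace

open Module

variable {V : Type*} [AddCommGroup V] [Module (ZMod 2) V] [Fintype V]

/-- The wave functions which are supported on `K` and invariant under translations by `B`. -/
def codeSpace (K B : Submodule (ZMod 2) V) : Submodule ℂ (EuclideanSpace ℂ V) where
  carrier := {ψ | (∀ s ∉ K, ψ s = 0) ∧ ∀ b ∈ B, ∀ s, ψ (s + b) = ψ s}
  add_mem' := by
    rintro ψ φ ⟨h1, h2⟩ ⟨h3, h4⟩
    exact ⟨fun s hs => by simp [h1 s hs, h3 s hs], fun b hb s => by simp [h2 b hb s, h4 b hb s]⟩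
  zero_mem' := ⟨fun _ _ => rfl, fun _ _ _ => rfl⟩
  smul_mem' := by
    rintro c ψ ⟨h1, h2⟩
    exact ⟨fun s hs => by simp [h1 s hs], fun b hb s => by simp [h2 b hb s]⟩

/-- Wave functions in the code space are functions on the quotient `K ⧸ B`. -/
def codeSpaceEquiv {K B : Submodule (ZMod 2) V} (hBK : B ≤ K) :
    codeSpace K B ≃ₗ[ℂ] ((K ⧸ B.comap K.subtype) → ℂ) := by
  classical
  exact
  { toFun := fun ψ q => ψ.1 (Quotient.out q : K)
    map_add' := fun ψ φ => rfl
    map_smul' := fun c ψ => rfl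
    invFun := fun φ => ⟨WithLp.toLp 2 fun s =>
        if h : s ∈ K then φ (Submodule.Quotient.mk ⟨s, h⟩) else 0, by
      refine ⟨fun s hs => dif_neg hs, fun b hb s => ?_⟩
      by_cases hs : s ∈ K
      · have hsb : s + b ∈ K := K.add_mem hs (hBK hb)
        have e : (Submodule.Quotient.mk ⟨s + b, hsb⟩ : K ⧸ B.comap K.subtype) =
            Submodule.Quotient.mk ⟨s, hs⟩ := by
          rw [Submodule.Quotient.eq]
          simpa using hb
        simp only [dif_pos hs, dif_pos hsb, e]
      · have hsb : s + b ∉ K := fun h => hs ((K.add_mem_iff_left (hBK hb)).1 h)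
        simp only [dif_neg hs, dif_neg hsb]⟩
    left_inv := fun ψ => by
      refine Subtype.ext ?_
      ext s
      by_cases hs : s ∈ K
      · simp only [dif_pos hs]
        set q : K ⧸ B.comap K.subtype := Submodule.Quotient.mk ⟨s, hs⟩ with hq
        have h1 : (Submodule.Quotient.mk (Quotient.out q) : K ⧸ B.comap K.subtype) =
            Submodule.Quotient.mk ⟨s, hs⟩ := Quotient.out_eq q
        rw [Submodule.Quotient.eq] at h1
        have h2 := ψ.2.2 _ h1 s
        simpa using h2
      · simp only [dif_neg hs]
        exact (ψ.2.1 s hs).symm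
    right_inv := fun φ => by
      funext q
      have h1 : ((Quotient.out q : K) : V) ∈ K := (Quotient.out q : K).2
      simp only [dif_pos h1]
      exact congrArg φ (Quotient.out_eq q) }

theorem finrank_codeSpace {K B : Submodule (ZMod 2) V} (hBK : B ≤ K) :
    finrank ℂ (codeSpace K B) = 2 ^ (finrank (ZMod 2) K - finrank (ZMod 2) B) := by
  classical
  have : Fintype (K ⧸ B.comap K.subtype) := Fintype.ofFinite _
  rw [LinearEquiv.finrank_eq (codeSpaceEquiv hBK), Module.finrank_fintype_fun_eq_card,
    Module.card_eq_pow_finrank (K := ZMod 2), ZMod.card, ← finrank_quotient_comap_subtype hBK,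
    Nat.add_sub_cancel]

end CodeSpace

/-! ### The ground states of the Hamiltonian -/

section GroundState

open Module

variable {X : Type*} [TopologicalSpace X] [T2Space X] {C : Set X} [CWComplex C]
  [CWComplex.Finite C] (A : Subcomplex C)

omit [T2Space X] in
theorem mem_codeSpace_iff (ψ : QubitSpace (BulkCell A 1)) :
    ψ ∈ codeSpace (relCocycles A) (relCoboundaries A) ↔
      (∀ p, plaquetteOp A p ψ = ψ) ∧ ∀ v, starOp A v ψ = ψ := by
  have habs : ∀ z : ℤ, ((z.natAbs : ℕ) : ZMod 2) = (z : ZMod 2) := by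
    intro z
    rw [← Int.cast_natCast]
    rcases Int.natAbs_eq z with h | h
    · rw [← h]
    · conv_rhs => rw [h]
      rw [Int.cast_neg, ZMod.neg_eq_self_mod_two]
  refine and_congr ?_ ?_
  · simp only [plaquetteOp, zString_eq_self_iff, habs, mem_relCocycles]
    constructor
    · intro h p s hs
      exact h s fun hc => hs (hc p)
    · intro h s hs
      obtain ⟨p, hp⟩ := not_forall.1 hs
      exact h p s hp
  · simp only [starOp, xString_eq_self_iff, relCoboundaries_eq_span]
    constructor
    · intro h v s
      exact h _ (Submodule.subset_span ⟨v, rfl⟩) s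
    · intro h b hb
      induction hb using Submodule.span_induction with
      | mem b hb =>
        obtain ⟨v, rfl⟩ := hb
        exact h v
      | zero => intro s; rw [add_zero]
      | add a b _ _ ha hb => intro s; rw [← add_assoc, hb, ha]
      | smul c b _ hb =>
        intro s
        rcases (by decide : ∀ c : ZMod 2, c = 0 ∨ c = 1) c with rfl | rfl
        · rw [zero_smul, add_zero]
        · rw [one_smul, hb]

/-- The energy of a state which is fixed by all plaquette and star operators. -/
def groundEnergy (g lam : ℝ) : ℝ :=
  -(1 / g ^ 2 * Fintype.card (BulkCell A 2)) - lam * Fintype.card (BulkCell A 0)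

omit [T2Space X] in
theorem hamiltonian_apply (g lam : ℝ) (ψ : QubitSpace (BulkCell A 1)) :
    hamiltonian A g lam ψ = -((1 / g ^ 2 : ℝ) : ℂ) • ∑ p, plaquetteOp A p ψ -
      (lam : ℂ) • ∑ v, starOp A v ψ := by
  simp [hamiltonian, LinearMap.sum_apply]

theorem two_mul_norm_sq_sub_re_inner {F : Type*} [NormedAddCommGroup F] [InnerProductSpace ℂ F]
    {ψ φ : F} (h : ‖φ‖ = ‖ψ‖) : 2 * (‖ψ‖ ^ 2 - (inner ℂ ψ φ).re) = ‖φ - ψ‖ ^ 2 := by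
  have h1 := norm_sub_sq (𝕜 := ℂ) ψ φ
  rw [norm_sub_rev φ ψ, h1, h]
  simp only [RCLike.re_to_complex]
  ring

omit [T2Space X] in
/-- The excess energy of an eigenstate is the sum of the defects `‖T ψ - ψ‖²` of the plaquette and
star operators `T`, which are unitary. -/
theorem sub_groundEnergy_mul_norm_sq {g lam E : ℝ} {ψ : QubitSpace (BulkCell A 1)}
    (h : hamiltonian A g lam ψ = (E : ℂ) • ψ) :
    2 * ((E - groundEnergy A g lam) * ‖ψ‖ ^ 2) =
      1 / g ^ 2 * ∑ p, ‖plaquetteOp A p ψ - ψ‖ ^ 2 + lam * ∑ v, ‖starOp A v ψ - ψ‖ ^ 2 := by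
  have h1 : ∀ p, ‖plaquetteOp A p ψ - ψ‖ ^ 2 =
      2 * (‖ψ‖ ^ 2 - (inner ℂ ψ (plaquetteOp A p ψ)).re) := fun p =>
    (two_mul_norm_sq_sub_re_inner (norm_zString _ ψ)).symm
  have h2 : ∀ v, ‖starOp A v ψ - ψ‖ ^ 2 =
      2 * (‖ψ‖ ^ 2 - (inner ℂ ψ (starOp A v ψ)).re) := fun v =>
    (two_mul_norm_sq_sub_re_inner (norm_xString _ ψ)).symm
  have h3 := congrArg (fun φ => (inner ℂ ψ φ).re) h
  simp only [hamiltonian_apply, inner_sub_right, inner_smul_right, inner_sum, neg_smul,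
    inner_neg_right, inner_self_eq_norm_sq_to_K, Complex.sub_re, Complex.neg_re,
    Complex.re_ofReal_mul, Complex.re_sum] at h3
  have h4 : (((‖ψ‖ : ℂ)) ^ 2).re = ‖ψ‖ ^ 2 := by
    rw [← Complex.ofReal_pow, Complex.ofReal_re]
  simp only [Complex.coe_algebraMap, h4] at h3
  simp only [h1, h2, ← Finset.mul_sum, Finset.sum_sub_distrib, Finset.sum_const,
    Finset.card_univ, nsmul_eq_mul, groundEnergy]
  linear_combination (-2) * h3

omit [T2Space X] in
theorem hamiltonian_of_fixed {g lam : ℝ} {ψ : QubitSpace (BulkCell A 1)}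
    (hp : ∀ p, plaquetteOp A p ψ = ψ) (hv : ∀ v, starOp A v ψ = ψ) :
    hamiltonian A g lam ψ = (groundEnergy A g lam : ℂ) • ψ := by
  rw [hamiltonian_apply]
  simp only [hp, hv, Finset.sum_const, Finset.card_univ, ← Nat.cast_smul_eq_nsmul ℂ, smul_smul,
    ← sub_smul, groundEnergy]
  push_cast
  congr 1
  ring

omit [T2Space X] in
theorem mem_eigenspace_groundEnergy_iff {g lam : ℝ} (hg : 0 < g) (hlam : 0 < lam)
    (ψ : QubitSpace (BulkCell A 1)) :
    ψ ∈ (hamiltonian A g lam).eigenspace (groundEnergy A g lam : ℂ) ↔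
      (∀ p, plaquetteOp A p ψ = ψ) ∧ ∀ v, starOp A v ψ = ψ := by
  rw [Module.End.mem_eigenspace_iff]
  refine ⟨fun h => ?_, fun h => hamiltonian_of_fixed A h.1 h.2⟩
  have h1 := sub_groundEnergy_mul_norm_sq A h
  rw [sub_self, zero_mul, mul_zero] at h1
  have hP : 0 ≤ ∑ p, ‖plaquetteOp A p ψ - ψ‖ ^ 2 := by positivity
  have hS : 0 ≤ ∑ v, ‖starOp A v ψ - ψ‖ ^ 2 := by positivity
  have hg2 : 0 < 1 / g ^ 2 := by positivity
  obtain ⟨h2, h3⟩ := (add_eq_zero_iff_of_nonneg (mul_nonneg hg2.le hP)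
    (mul_nonneg hlam.le hS)).1 h1.symm
  have h2' := (mul_eq_zero.1 h2).resolve_left hg2.ne'
  have h3' := (mul_eq_zero.1 h3).resolve_left hlam.ne'
  rw [Finset.sum_eq_zero_iff_of_nonneg fun _ _ => by positivity] at h2' h3'
  refine ⟨fun p => ?_, fun v => ?_⟩
  · simpa [sub_eq_zero] using h2' p (Finset.mem_univ p)
  · simpa [sub_eq_zero] using h3' v (Finset.mem_univ v)

omit [T2Space X] in
theorem eigenspace_groundEnergy {g lam : ℝ} (hg : 0 < g) (hlam : 0 < lam) :
    (hamiltonian A g lam).eigenspace (groundEnergy A g lam : ℂ) =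
      codeSpace (relCocycles A) (relCoboundaries A) := by
  ext ψ
  rw [mem_eigenspace_groundEnergy_iff A hg hlam, mem_codeSpace_iff]

theorem finrank_eigenspace_groundEnergy {g lam : ℝ} (hg : 0 < g) (hlam : 0 < lam) :
    finrank ℂ ((hamiltonian A g lam).eigenspace (groundEnergy A g lam : ℂ)) =
      2 ^ (finrank (ZMod 2) (relCocycles A) - finrank (ZMod 2) (relCoboundaries A)) := by
  rw [eigenspace_groundEnergy A hg hlam, finrank_codeSpace (relCoboundaries_le A)]

theorem isGroundEnergy_groundEnergy {g lam : ℝ} (hg : 0 < g) (hlam : 0 < lam) :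
    IsGroundEnergy (hamiltonian A g lam) (groundEnergy A g lam) := by
  constructor
  · intro hbot
    have h := finrank_eigenspace_groundEnergy A hg hlam
    have hbot' : (hamiltonian A g lam).eigenspace (groundEnergy A g lam : ℂ) = ⊥ := hbot
    rw [hbot', finrank_bot] at h
    exact absurd h.symm (by positivity)
  · intro E hE
    obtain ⟨ψ, hψ⟩ := hE.exists_hasEigenvector
    have h1 := sub_groundEnergy_mul_norm_sq A hψ.apply_eq_smul
    have hP : 0 ≤ ∑ p, ‖plaquetteOp A p ψ - ψ‖ ^ 2 := by positivity
    have hS : 0 ≤ ∑ v, ‖starOp A v ψ - ψ‖ ^ 2 := by positivity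
    have hg2 : 0 < 1 / g ^ 2 := by positivity
    have h2 := add_nonneg (mul_nonneg hg2.le hP) (mul_nonneg hlam.le hS)
    rw [← h1] at h2
    have hn : 0 < ‖ψ‖ ^ 2 := by
      have := norm_pos_iff.2 hψ.2
      positivity
    have h3 : 0 ≤ E - groundEnergy A g lam :=
      nonneg_of_mul_nonneg_left (by linarith) hn
    linarith

end GroundState

/-! ### Balls -/

section Ball

variable {X : Type*} [TopologicalSpace X]

/-- Alexander–Spanier one-cocycles on a set homeomorphic to a closed ball have primitives. -/
theorem IsLocCocycle.exists_isLocPrimitive_of_homeomorph_closedBall {C : Set X} {k : ℕ}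
    (h : C ≃ₜ Metric.closedBall (0 : EuclideanSpace ℝ (Fin k)) 1) {φ : X → X → ZMod 2}
    (hφ : IsLocCocycle C φ) : ∃ f, IsLocPrimitive C φ f := by
  classical
  set D := Metric.closedBall (0 : EuclideanSpace ℝ (Fin k)) 1 with hD
  have hD0 : (0 : EuclideanSpace ℝ (Fin k)) ∈ D := Metric.mem_closedBall_self zero_le_one
  -- total extensions of the homeomorphism and of its inverse
  set a : EuclideanSpace ℝ (Fin k) → X := fun u =>
    if hu : u ∈ D then (h.symm ⟨u, hu⟩ : X) else h.symm ⟨0, hD0⟩ with ha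
  set b : X → EuclideanSpace ℝ (Fin k) := fun x => if hx : x ∈ C then h ⟨x, hx⟩ else 0 with hb
  have ha' : ∀ u (hu : u ∈ D), a u = h.symm ⟨u, hu⟩ := fun u hu => dif_pos hu
  have hb' : ∀ x (hx : x ∈ C), b x = h ⟨x, hx⟩ := fun x hx => dif_pos hx
  have hac : ContinuousOn a D := by
    rw [continuousOn_iff_continuous_domRestrict]
    have : D.domRestrict a = fun u => (h.symm u : X) := funext fun u => ha' u u.2
    rw [this]
    exact continuous_subtype_val.comp h.symm.continuous
  have hbc : ContinuousOn b C := by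
    rw [continuousOn_iff_continuous_domRestrict]
    have : C.domRestrict b = fun x => (h x : EuclideanSpace ℝ (Fin k)) :=
      funext fun x => hb' x x.2
    rw [this]
    exact continuous_subtype_val.comp h.continuous
  have ham : MapsTo a D C := fun u hu => by rw [ha' u hu]; exact Subtype.property _
  have hbm : MapsTo b C D := fun x hx => by rw [hb' x hx]; exact Subtype.property _
  have hab : ∀ x ∈ C, a (b x) = x := fun x hx => by
    rw [ha' _ (hbm hx)]
    have : (⟨b x, hbm hx⟩ : D) = h ⟨x, hx⟩ := Subtype.ext (hb' x hx)
    rw [this, h.symm_apply_apply]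
  obtain ⟨f, hf⟩ := (hφ.comap hac ham).exists_isLocPrimitive_of_contraction
    (isCompact_closedBall _ _) (H := fun p => p.1 • p.2) (x₀ := 0)
    (continuous_fst.smul continuous_snd).continuousOn
    (by
      rintro ⟨t, u⟩ ⟨ht, hu⟩
      rw [mem_closedBall_zero_iff] at hu ⊢
      rw [norm_smul, Real.norm_of_nonneg ht.1]
      exact mul_le_one₀ ht.2 (norm_nonneg _) hu)
    (fun u _ => by simp) (fun u _ => by simp)
  refine ⟨fun x => f (b x), (hf.comap hbc hbm).congr (fun x hx y hy => ?_) fun _ _ => rfl⟩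
  rw [hab x hx, hab y hy]

/-- A set which corresponds to the boundary sphere of a ball of dimension at least two is
connected. -/
theorem isConnected_of_homeomorph_closedBall {C A : Set X} (hAC : A ⊆ C) {k : ℕ} (hk : 2 ≤ k)
    (h : C ≃ₜ Metric.closedBall (0 : EuclideanSpace ℝ (Fin k)) 1)
    (hA : ∀ x : C, (x : X) ∈ A ↔
      (h x : EuclideanSpace ℝ (Fin k)) ∈ Metric.sphere (0 : EuclideanSpace ℝ (Fin k)) 1) :
    IsConnected A := by
  have hs : IsConnected (Metric.sphere (0 : EuclideanSpace ℝ (Fin k)) 1) := by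
    refine isConnected_sphere ?_ 0 zero_le_one
    rw [← Module.finrank_eq_rank, finrank_euclideanSpace_fin]
    exact_mod_cast hk
  have hs' : IsConnected ((fun u : Metric.closedBall (0 : EuclideanSpace ℝ (Fin k)) 1 =>
      (h.symm u : X)) '' (Subtype.val ⁻¹' Metric.sphere 0 1)) := by
    refine IsConnected.image ?_ _ (continuous_subtype_val.comp h.symm.continuous).continuousOn
    have himage : (Subtype.val : Metric.closedBall (0 : EuclideanSpace ℝ (Fin k)) 1 → _) ''
        (Subtype.val ⁻¹' Metric.sphere 0 1) = Metric.sphere 0 1 := by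
      rw [Subtype.image_preimage_coe, inter_eq_right]
      exact Metric.sphere_subset_closedBall
    rw [← himage] at hs
    exact ⟨hs.nonempty.of_image, Topology.IsInducing.subtypeVal.isPreconnected_image.1
      hs.isPreconnected⟩
  convert hs'
  ext x
  constructor
  · intro hx
    refine ⟨h ⟨x, hAC hx⟩, (hA ⟨x, hAC hx⟩).1 hx, ?_⟩
    simp
  · rintro ⟨u, hu, rfl⟩
    rw [hA]
    simpa using hu

end Ball

end ToricCode

end

theorem mainTheorem6 {X : Type*} [TopologicalSpace X] [T2Space X] (C : Set X)
    [Topology.CWComplex C] [Topology.CWComplex.Finite C] (hC : IsConnected C)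
    (A : Topology.CWComplex.Subcomplex C) (g lam : ℝ) (hg : 0 < g) (hlam : 0 < lam) :
    ∃ E₀ : ℝ, ToricCode.IsGroundEnergy (ToricCode.hamiltonian A g lam) E₀ ∧
      -- the ground states are the states fixed by all plaquette and star operators
      (∀ ψ : ToricCode.QubitSpace (ToricCode.BulkCell A 1),
        ψ ∈ (ToricCode.hamiltonian A g lam).eigenspace (E₀ : ℂ) ↔
          (∀ p, ToricCode.plaquetteOp A p ψ = ψ) ∧ ∀ v, ToricCode.starOp A v ψ = ψ) ∧
      -- no boundary
      ((A : Set X) = ∅ →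
        Module.finrank ℂ ((ToricCode.hamiltonian A g lam).eigenspace (E₀ : ℂ)) =
          2 ^ ToricCode.betti₁ C) ∧
      -- nonempty boundary
      ((A : Set X).Nonempty →
        (Module.finrank ℂ ((ToricCode.hamiltonian A g lam).eigenspace (E₀ : ℂ)) : ℚ) =
          2 ^ ((ToricCode.betti₀ (A : Set X) : ℤ) - 1 + ToricCode.betti₁ C -
            ToricCode.betti₁NT A)) ∧
      -- a ball of dimension other than one, with its boundary sphere
      (∀ (k : ℕ) (h : C ≃ₜ Metric.closedBall (0 : EuclideanSpace ℝ (Fin k)) 1), k ≠ 1 →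
        (∀ x : C, (x : X) ∈ (A : Set X) ↔
          (h x : EuclideanSpace ℝ (Fin k)) ∈ Metric.sphere (0 : EuclideanSpace ℝ (Fin k)) 1) →
        Module.finrank ℂ ((ToricCode.hamiltonian A g lam).eigenspace (E₀ : ℂ)) = 1) := by
  have hle := Submodule.finrank_mono (ToricCode.relCoboundaries_le A)
  have hrank := ToricCode.finrank_eigenspace_groundEnergy A hg hlam
  refine ⟨ToricCode.groundEnergy A g lam, ToricCode.isGroundEnergy_groundEnergy A hg hlam,
    ToricCode.mem_eigenspace_groundEnergy_iff A hg hlam, fun hA => ?_, fun hA => ?_,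
    fun k h hk hA => ?_⟩
  · have hsub := ToricCode.finrank_relCocycles_sub_of_eq_empty A hA
    rw [hrank]
    congr 1
    omega
  · have hsub := ToricCode.finrank_relCocycles_sub_of_nonempty A hC hA
    rw [hrank, ← hsub, ← Nat.cast_sub hle, zpow_natCast]
    push_cast
    rfl
  · have hb : ToricCode.betti₁ C = 0 := ToricCode.betti₁_eq_zero fun φ hφ =>
      hφ.exists_isLocPrimitive_of_homeomorph_closedBall h
    rw [hrank, Nat.pow_eq_one]
    right
    rcases Nat.lt_or_ge k 2 with hk2 | hk2
    · -- the zero-dimensional ball has empty boundary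
      obtain rfl : k = 0 := by omega
      have hA0 : (A : Set X) = ∅ := by
        refine Set.eq_empty_of_forall_notMem fun x hx => ?_
        have := (hA ⟨x, Topology.RelCWComplex.Subcomplex.subset_complex A hx⟩).1 hx
        rw [mem_sphere_zero_iff_norm, Subsingleton.elim (h _).1 0, norm_zero] at this
        exact zero_ne_one this
      have hsub := ToricCode.finrank_relCocycles_sub_of_eq_empty A hA0
      omega
    · have hAc := ToricCode.isConnected_of_homeomorph_closedBall
        (Topology.RelCWComplex.Subcomplex.subset_complex A) hk2 h hA
      have hsub := ToricCode.finrank_relCocycles_sub_of_nonempty A hC hAc.nonempty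
      have h0 := ToricCode.betti₀_eq_one hAc
      have hNT := ToricCode.betti₁NT_le A
      omega
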